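/- Let $M$ be a smooth $n$-dimensional manifold and let $(M,K)$ be a Cartan space: $K:T^*M\to\mathbb{R}$ is continuous, smooth and positive off the zero section, positively $1$-homogeneous in the momenta, and in the coordinates $(x^i,p_i)$ induced on $T^*M$ by any chart of $M$ the matrix $g^{ij}=\frac12\,\partial^i\partial^jK^2$, where $\partial^i=\partial/\partial p_i$, is positive definite off the zero section. Let $(g_{ij})=(g^{ij})^{-1}$, let $\{f,g\}=\frac{\partial f}{\partial p_i}\frac{\partial g}{\partial x^i}-\frac{\partial g}{\partial p_i}\frac{\partial f}{\partial x^i}$, and put $$N_{ij}=\tfrac14\{g_{ij},K^2\}-\tfrac14\Big(g_{ik}\frac{\partial^2K^2}{\partial p_k\partial x^j}+g_{jk}\frac{\partial^2K^2}{\partial p_k\partial x^i}\Big),\qquad \frac{\delta}{\delta x^i}=\frac{\partial}{\partial x^i}+N_{ij}\partial^j,\qquad \delta p_i=dp_i-N_{ij}dx^j .$$ Let $G=g_{ij}\,dx^i\otimes dx^j+g^{ij}\,\delta p_i\otimes\delta p_j$ be the Sasaki lift, a Riemannian metric on $T^*M\setminus\{0\}$ with Levi-Civita connection $\nabla$, let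 $C^*=p_i\partial^i$, let $J=g^{ij}\frac{\delta}{\delta x^j}\otimes\delta p_i-g_{ij}\,\partial^j\otimes dx^i$, and let $\xi=J(C^*)=g^{ij}p_i\frac{\delta}{\delta x^j}$. Put $R_{ijk}=\frac{\delta N_{jk}}{\delta x^i}-\frac{\delta N_{ik}}{\delta x^j}$, $R_{ij}=p_hg^{hk}R_{ikj}$ and $h_{ij}=g_{ij}-\frac{1}{K^2}p_ip_j$, and let the angular curvature be $\Lambda^*_{ij}=R_{ij}+h_{ij}$. For $c>0$ let $I^*M(c)=\{(x,p)\in T^*M : K(x,p)=c\}$; the vector field $\xi$ is tangent to $I^*M(c)$. Then $G$ is bundle-like on $I^*M(c)$ for the one-dimensional foliation spanned by $\xi$, that is, $$G(\nabla_XY+\nabla_YX,\xi)=0\quad\text{on } I^*M(c)$$ for all local smooth vector fields $X,Y$ that are, along $I^*M(c)$, tangent to $I^*M(c)$ and orthogonal to $\xi$, if and only if $\Lambda^*=0$ on $I^*M(c)$. -/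

import Mathlib

open scoped Manifold ContDiff

noncomputable section

namespace CartanGeom

/-! ### Local (coordinate) geometry

A point of the coordinate space is `z = (x, p)`, with positions `x^i = z.1 i` and momenta
`p_i = z.2 i`; a tangent vector `v` at `z` is `v.1 i • ∂/∂x^i + v.2 i • ∂/∂p_i`.
In this section `F` stands for the coordinate expression of the fundamental function `K`. -/

/-- The coordinate space `(x^i, p_i)`. -/
abbrev Phase (n : ℕ) : Type := EuclideanSpace ℝ (Fin n) × EuclideanSpace ℝ (Fin n)

variable {n : ℕ}

/-- The coordinate vector `∂/∂x^i`. -/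
def eX (i : Fin n) : Phase n := (EuclideanSpace.single i 1, 0)

/-- The coordinate vector `∂^i = ∂/∂p_i`. -/
def eP (i : Fin n) : Phase n := (0, EuclideanSpace.single i 1)

/-- The partial derivative `∂f/∂x^i`. -/
def dX (i : Fin n) (f : Phase n → ℝ) (z : Phase n) : ℝ := fderiv ℝ f z (eX i)

/-- The partial derivative `∂^i f = ∂f/∂p_i`. -/
def dP (i : Fin n) (f : Phase n → ℝ) (z : Phase n) : ℝ := fderiv ℝ f z (eP i)

/-- The Poisson bracket `{f, g} = ∂f/∂p_i ∂g/∂x^i - ∂g/∂p_i ∂f/∂x^i`. -/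
def poisson (f g : Phase n → ℝ) (z : Phase n) : ℝ :=
  ∑ i, (dP i f z * dX i g z - dP i g z * dX i f z)

/-- The function `K²` in coordinates. -/
def sqF (F : Phase n → ℝ) (z : Phase n) : ℝ := F z ^ 2

/-- `g^{ij} = ½ ∂^i ∂^j K²`. -/
def gUp (F : Phase n → ℝ) (z : Phase n) : Matrix (Fin n) (Fin n) ℝ :=
  Matrix.of fun i j => (1 / 2 : ℝ) * dP i (dP j (sqF F)) z

/-- `(g_{ij})`, the inverse matrix of `(g^{ij})`. -/
def gLow (F : Phase n → ℝ) (z : Phase n) : Matrix (Fin n) (Fin n) ℝ := (gUp F z)⁻¹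

/-- The coefficients `N_{ij}` of the canonical nonlinear connection. -/
def nonlin (F : Phase n → ℝ) (i j : Fin n) (z : Phase n) : ℝ :=
  (1 / 4 : ℝ) * poisson (fun w => gLow F w i j) (sqF F) z
    - (1 / 4 : ℝ) * ∑ k, (gLow F z i k * dP k (dX j (sqF F)) z
        + gLow F z j k * dP k (dX i (sqF F)) z)

/-- The horizontal vector `δ/δx^i = ∂/∂x^i + N_{ij} ∂^j`. -/
def eDelta (F : Phase n → ℝ) (i : Fin n) (z : Phase n) : Phase n :=
  eX i + ∑ j, nonlin F i j z • eP j

/-- The derivative `δf/δx^i`. -/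
def dDelta (F : Phase n → ℝ) (i : Fin n) (f : Phase n → ℝ) (z : Phase n) : ℝ :=
  fderiv ℝ f z (eDelta F i z)

/-- The 1-form `δp_i = dp_i - N_{ij} dx^j`, evaluated on the tangent vector `v` at `z`. -/
def deltaP (F : Phase n → ℝ) (i : Fin n) (z v : Phase n) : ℝ :=
  v.2 i - ∑ j, nonlin F i j z * v.1 j

/-- The Sasaki lift `G = g_{ij} dx^i ⊗ dx^j + g^{ij} δp_i ⊗ δp_j`. -/
def sasaki (F : Phase n → ℝ) (z v w : Phase n) : ℝ :=
  (∑ i, ∑ j, gLow F z i j * v.1 i * w.1 j)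
    + ∑ i, ∑ j, gUp F z i j * deltaP F i z v * deltaP F j z w

/-- The almost complex structure `J = g^{ij} δ/δx^j ⊗ δp_i - g_{ij} ∂^j ⊗ dx^i`. -/
def almostJ (F : Phase n → ℝ) (z v : Phase n) : Phase n :=
  (∑ i, ∑ j, (gUp F z i j * deltaP F i z v) • eDelta F j z)
    - ∑ i, ∑ j, (gLow F z i j * v.1 i) • eP j

/-- The Liouville-Hamilton vector field `C* = p_i ∂^i`. -/
def liouville (z : Phase n) : Phase n := ∑ i, z.2 i • eP i

/-- The vector field `ξ = J(C*)`. -/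
def xi (F : Phase n → ℝ) (z : Phase n) : Phase n := almostJ F z (liouville z)

/-- `R_{ijk} = δN_{jk}/δx^i - δN_{ik}/δx^j`. -/
def curv3 (F : Phase n → ℝ) (i j k : Fin n) (z : Phase n) : ℝ :=
  dDelta F i (nonlin F j k) z - dDelta F j (nonlin F i k) z

/-- `R_{ij} = p_h g^{hk} R_{ikj}`. -/
def curv2 (F : Phase n → ℝ) (i j : Fin n) (z : Phase n) : ℝ :=
  ∑ h, ∑ k, z.2 h * gUp F z h k * curv3 F i k j z

/-- The angular metric `h_{ij} = g_{ij} - p_i p_j / K²`. -/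
def angMetric (F : Phase n → ℝ) (i j : Fin n) (z : Phase n) : ℝ :=
  gLow F z i j - z.2 i * z.2 j / F z ^ 2

/-- The angular curvature `Λ*_{ij} = R_{ij} + h_{ij}`. -/
def angCurv (F : Phase n → ℝ) (i j : Fin n) (z : Phase n) : ℝ :=
  curv2 F i j z + angMetric F i j z

/-! ### The Levi-Civita connection of `G` in coordinates -/

/-- The coordinate frame `∂/∂x^1, …, ∂/∂x^n, ∂^1, …, ∂^n`. -/
def frame : Fin n ⊕ Fin n → Phase n := Sum.elim eX eP

/-- The components of a vector in the coordinate frame. -/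
def comp (v : Phase n) : Fin n ⊕ Fin n → ℝ := Sum.elim (fun i => v.1 i) (fun i => v.2 i)

/-- The matrix `G_{AB}` of the Sasaki lift in the coordinate frame. -/
def sasakiMat (F : Phase n → ℝ) (z : Phase n) : Matrix (Fin n ⊕ Fin n) (Fin n ⊕ Fin n) ℝ :=
  Matrix.of fun A B => sasaki F z (frame A) (frame B)

/-- The derivative `∂_A G_{BC}`. -/
def dSasaki (F : Phase n → ℝ) (A B C : Fin n ⊕ Fin n) (z : Phase n) : ℝ :=
  fderiv ℝ (fun w => sasakiMat F w B C) z (frame A)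

/-- The Christoffel symbols
`Γ^C_{AB} = ½ G^{CD} (∂_A G_{BD} + ∂_B G_{AD} - ∂_D G_{AB})`. -/
def christoffel (F : Phase n → ℝ) (C A B : Fin n ⊕ Fin n) (z : Phase n) : ℝ :=
  (1 / 2 : ℝ) * ∑ D, (sasakiMat F z)⁻¹ C D *
    (dSasaki F A B D z + dSasaki F B A D z - dSasaki F D A B z)

/-- The Levi-Civita covariant derivative `∇_X Y` of the metric `G`. -/
def nabla (F : Phase n → ℝ) (X Y : Phase n → Phase n) (z : Phase n) : Phase n :=
  fderiv ℝ Y z (X z)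
    + ∑ C, (∑ A, ∑ B, christoffel F C A B z * comp (X z) A * comp (Y z) B) • frame C

/-! ### Cartan spaces -/

variable {M : Type*} [TopologicalSpace M] [ChartedSpace (EuclideanSpace ℝ (Fin n)) M]

variable (n M) in
/-- The cotangent bundle `T*M`. -/
abbrev Cotangent [IsManifold (𝓡 n) ∞ M] : Type _ :=
  Bundle.TotalSpace (EuclideanSpace ℝ (Fin n) →L[ℝ] ℝ)
    (fun x : M => TangentSpace (𝓡 n) x →L[ℝ] ℝ)

/-- The covector `p_i dx^i` at the point with coordinates `x`, for the local coordinates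
`(x^1, …, x^n)` given by the chart `φ`: the inverse of the induced coordinate system on `T*M`. -/
def covectorAt [IsManifold (𝓡 n) ∞ M]
    (φ : OpenPartialHomeomorph M (EuclideanSpace ℝ (Fin n))) (z : Phase n) : Cotangent n M :=
  ⟨φ.symm z.1, ∑ i, z.2 i •
    ((EuclideanSpace.proj i : EuclideanSpace ℝ (Fin n) →L[ℝ] ℝ).comp
      (mfderiv (𝓡 n) (𝓡 n) φ (φ.symm z.1)))⟩

/-- The coordinates `(x, p)` of the covectors over the domain of `φ` that are not zero. -/
def slit (φ : OpenPartialHomeomorph M (EuclideanSpace ℝ (Fin n))) : Set (Phase n) :=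
  {z | z.1 ∈ φ.target ∧ z.2 ≠ 0}

/-- A Cartan space `(M, K)` over the smooth `n`-manifold `M`. -/
structure CartanSpace (n : ℕ) (M : Type*) [TopologicalSpace M]
    [ChartedSpace (EuclideanSpace ℝ (Fin n)) M] [IsManifold (𝓡 n) ∞ M] where
  /-- The fundamental function on `T*M`. -/
  K : Cotangent n M → ℝ
  continuous_K : Continuous K
  smooth_K : ContMDiffOn ((𝓡 n).prod 𝓘(ℝ, EuclideanSpace ℝ (Fin n) →L[ℝ] ℝ)) 𝓘(ℝ) ∞ K
    {v | v.2 ≠ 0}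
  pos_K : ∀ v : Cotangent n M, v.2 ≠ 0 → 0 < K v
  homog_K : ∀ (x : M) (p : TangentSpace (𝓡 n) x →L[ℝ] ℝ) (t : ℝ), 0 < t →
    K ⟨x, t • p⟩ = t * K ⟨x, p⟩
  posDef_K : ∀ φ ∈ IsManifold.maximalAtlas (𝓡 n) ∞ M, ∀ z ∈ slit φ,
    (gUp (fun w => K (covectorAt φ w)) z).PosDef

namespace CartanSpace

variable [IsManifold (𝓡 n) ∞ M]

/-- The expression of `K` in the coordinates induced by the chart `φ`. -/
def localK (S : CartanSpace n M) (φ : OpenPartialHomeomorph M (EuclideanSpace ℝ (Fin n)))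
    (z : Phase n) : ℝ := S.K (covectorAt φ z)

/-- The `c`-indicatrix `I*M(c) = {K = c}`. -/
def indicatrix (S : CartanSpace n M) (c : ℝ) : Set (Cotangent n M) := {v | S.K v = c}

/-- The coordinate vector field `X` is, at each point of `W` which lies on `I*M(c)`, tangent to
`I*M(c)` (that is, `dK(X) = 0`) and `G`-orthogonal to `ξ`. So, along `I*M(c)`, it is a section of
the orthogonal complement of `ξ` in `T I*M(c)`. -/
def IsTransverse (S : CartanSpace n M) (c : ℝ)
    (φ : OpenPartialHomeomorph M (EuclideanSpace ℝ (Fin n))) (W : Set (Phase n))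
    (X : Phase n → Phase n) : Prop :=
  ∀ z ∈ W, covectorAt φ z ∈ S.indicatrix c →
    fderiv ℝ (S.localK φ) z (X z) = 0 ∧
      sasaki (S.localK φ) z (X z) (xi (S.localK φ) z) = 0

/-- `G` is bundle-like on `I*M(c)` for the foliation spanned by `ξ`:
`G(∇_X Y + ∇_Y X, ξ) = 0` on `I*M(c)` for all local smooth vector fields `X`, `Y` that are,
along `I*M(c)`, tangent to `I*M(c)` and orthogonal to `ξ`. (As `ξ` is tangent to `I*M(c)`,
it makes no difference whether `∇` is the connection of `G` or of its restriction.) -/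
def IsBundleLike (S : CartanSpace n M) (c : ℝ) : Prop :=
  ∀ φ ∈ IsManifold.maximalAtlas (𝓡 n) ∞ M, ∀ W : Set (Phase n), IsOpen W → W ⊆ slit φ →
    ∀ X Y : Phase n → Phase n, ContDiffOn ℝ ∞ X W → ContDiffOn ℝ ∞ Y W →
      S.IsTransverse c φ W X → S.IsTransverse c φ W Y →
        ∀ z ∈ W, covectorAt φ z ∈ S.indicatrix c →
          sasaki (S.localK φ) z
            (nabla (S.localK φ) X Y z + nabla (S.localK φ) Y X z) (xi (S.localK φ) z) = 0

/-- The angular curvature `Λ*` vanishes on `I*M(c)`. -/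
def AngularCurvatureVanishes (S : CartanSpace n M) (c : ℝ) : Prop :=
  ∀ φ ∈ IsManifold.maximalAtlas (𝓡 n) ∞ M, ∀ z ∈ slit φ,
    covectorAt φ z ∈ S.indicatrix c → ∀ i j, angCurv (S.localK φ) i j z = 0

end CartanSpace

end CartanGeom

end

noncomputable section

namespace CartanGeom

variable {n : ℕ}

/-! Idea. Everything is computed in induced coordinates, with matrices in place of indices. Euler's
relations for the 2-homogeneous function `K²`, together with the formula for `N`, give `N_{ij} p^j =
-½ ∂K²/∂x^i` (`nonlinMat_mulVec_vel`), so `ξ` is horizontal and is the Hamiltonian field of `½K²`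
(`xi_eq_ham`).

If `X` and `Y` are tangent to a level of `K` and orthogonal to `ξ` along it, differentiating `G(Y,
ξ) = 0` along `X` and `G(X, ξ) = 0` along `Y` shows that `G(∇_X Y + ∇_Y X, ξ) = -(L_ξ G)(X, Y)`. So
the question is when the Lie derivative of `G` along `ξ` vanishes on transverse vectors.

In the splitting into horizontal and vertical parts, the two diagonal blocks of `L_ξ G` vanish: `N`
is defined from the derivative of `g_{ij}` along `ξ` in just the way that makes them cancel. The
mixed block is `1 + R g⁻¹ = (R + g) g⁻¹` (`lie_sasaki`). On vectors orthogonal to `ξ`, whose base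
part is annihilated by `p`, the matrix `R + g` may be replaced by `R + g - p pᵀ / K² = Λ*`
(`sasaki_nabla_xi`).

Hence `Λ* = 0` implies bundle-like. Conversely, `Λ*` is symmetric and annihilates `p^i`, so
projecting constant horizontal and vertical vectors to transverse ones loses no information, and
pairing one of each kind recovers every entry of `Λ*` (`horField_angCurv_verField`). -/

/-- `F` is the coordinate expression, on the open cone `U`, of the fundamental function of a
Cartan space. -/
structure IsLocalCartan (F : Phase n → ℝ) (U : Set (Phase n)) : Prop where
  isOpen : IsOpen U
  smooth : ContDiffOn ℝ ∞ F U
  cone : ∀ z ∈ U, ∀ t : ℝ, 0 < t → (z.1, t • z.2) ∈ U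
  pos : ∀ z ∈ U, 0 < F z
  homog : ∀ z ∈ U, ∀ t : ℝ, 0 < t → F (z.1, t • z.2) = t * F z
  posDef : ∀ z ∈ U, (gUp F z).PosDef

open Matrix

/-! ### Partial derivatives -/

lemma sum_eX_add_sum_eP (v : Phase n) : ∑ i, v.1 i • eX i + ∑ i, v.2 i • eP i = v := by
  ext j <;> simp [eX, eP, Prod.fst_sum, Prod.snd_sum, Pi.single_apply]

lemma fderiv_eq_sum (f : Phase n → ℝ) (z v : Phase n) :
    fderiv ℝ f z v = ∑ i, v.1 i * dX i f z + ∑ i, v.2 i * dP i f z := by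
  conv_lhs => rw [← sum_eX_add_sum_eP v]
  simp [dX, dP, map_sum]

lemma contDiffOn_fderiv_apply {f : Phase n → ℝ} {U : Set (Phase n)} (hU : IsOpen U)
    (hf : ContDiffOn ℝ ∞ f U) (v : Phase n) : ContDiffOn ℝ ∞ (fun z => fderiv ℝ f z v) U :=
  (hf.fderiv_of_isOpen hU (by simp)).clm_apply contDiffOn_const

lemma contDiffOn_dX {f : Phase n → ℝ} {U : Set (Phase n)} (hU : IsOpen U)
    (hf : ContDiffOn ℝ ∞ f U) (i : Fin n) : ContDiffOn ℝ ∞ (dX i f) U :=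
  contDiffOn_fderiv_apply hU hf _

lemma contDiffOn_dP {f : Phase n → ℝ} {U : Set (Phase n)} (hU : IsOpen U)
    (hf : ContDiffOn ℝ ∞ f U) (i : Fin n) : ContDiffOn ℝ ∞ (dP i f) U :=
  contDiffOn_fderiv_apply hU hf _

lemma _root_.ContDiffOn.differentiableAt_of_isOpen {f : Phase n → ℝ} {U : Set (Phase n)}
    (hf : ContDiffOn ℝ ∞ f U) (hU : IsOpen U) {z : Phase n} (hz : z ∈ U) :
    DifferentiableAt ℝ f z :=
  (hf.contDiffAt (hU.mem_nhds hz)).differentiableAt (by simp)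

lemma fderiv_fderiv_apply_comm {f : Phase n → ℝ} {U : Set (Phase n)} (hU : IsOpen U)
    (hf : ContDiffOn ℝ ∞ f U) {z : Phase n} (hz : z ∈ U) (u v : Phase n) :
    fderiv ℝ (fun w => fderiv ℝ f w u) z v = fderiv ℝ (fun w => fderiv ℝ f w v) z u := by
  have hd : DifferentiableAt ℝ (fderiv ℝ f) z :=
    ((hf.fderiv_of_isOpen hU (m := ∞) (by simp)).contDiffAt (hU.mem_nhds hz)).differentiableAt
      (by simp)
  rw [fderiv_clm_apply hd (differentiableAt_const _), fderiv_clm_apply hd (differentiableAt_const _)]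
  have hs : IsSymmSndFDerivAt ℝ f z :=
    (hf.contDiffAt (hU.mem_nhds hz)).isSymmSndFDerivAt (by
      rw [minSmoothness_of_isRCLikeNormedField]; exact WithTop.coe_le_coe.2 (le_top : (2 : ℕ∞) ≤ ⊤))
  simpa using hs v u

/-! ### The matrices attached to a Cartan space -/

/-- The matrix `∂²K²/∂p_k∂x^j`. -/
def mixedHess (F : Phase n → ℝ) (z : Phase n) : Matrix (Fin n) (Fin n) ℝ :=
  Matrix.of fun k j => dP k (dX j (sqF F)) z

/-- The matrix `∂²K²/∂x^k∂x^j`. -/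
def baseHess (F : Phase n → ℝ) (z : Phase n) : Matrix (Fin n) (Fin n) ℝ :=
  Matrix.of fun k j => dX k (dX j (sqF F)) z

/-- The matrix `(N_{ij})`. -/
def nonlinMat (F : Phase n → ℝ) (z : Phase n) : Matrix (Fin n) (Fin n) ℝ :=
  Matrix.of fun i j => nonlin F i j z

/-- The momenta `p_i`. -/
def mom (z : Phase n) : Fin n → ℝ := z.2.ofLp

/-- The velocities `p^i = g^{ij} p_j`. -/
def vel (F : Phase n → ℝ) (z : Phase n) : Fin n → ℝ := gUp F z *ᵥ mom z

/-- The entrywise derivative of a matrix valued function. -/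
def matDeriv (A : Phase n → Matrix (Fin n) (Fin n) ℝ) (z u : Phase n) :
    Matrix (Fin n) (Fin n) ℝ :=
  Matrix.of fun i j => fderiv ℝ (fun w => A w i j) z u

/-- The Hamiltonian vector field of `½ K²`. -/
def ham (F : Phase n → ℝ) (z : Phase n) : Phase n :=
  (WithLp.toLp 2 fun i => (1 / 2 : ℝ) * dP i (sqF F) z,
    WithLp.toLp 2 fun i => -(1 / 2 : ℝ) * dX i (sqF F) z)

/-- Turns the bracket in the definition of `N` into a derivative along the Hamiltonian field, which
is later identified with `ξ`. -/
lemma poisson_sqF (F f : Phase n → ℝ) (z : Phase n) :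
    poisson f (sqF F) z = -2 * fderiv ℝ f z (ham F z) := by
  rw [fderiv_eq_sum, poisson]
  simp only [ham, ← Finset.sum_add_distrib, Finset.mul_sum]
  refine Finset.sum_congr rfl fun i _ => ?_
  ring

namespace IsLocalCartan

variable {F : Phase n → ℝ} {U : Set (Phase n)} (hF : IsLocalCartan F U)
include hF

lemma contDiffOn_sqF : ContDiffOn ℝ ∞ (sqF F) U := hF.smooth.pow 2

lemma contDiffOn_gUp (i j : Fin n) : ContDiffOn ℝ ∞ (fun z => gUp F z i j) U :=
  contDiffOn_const.mul (contDiffOn_dP hF.isOpen (contDiffOn_dP hF.isOpen hF.contDiffOn_sqF j) i)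

lemma isUnit_det_gUp {z : Phase n} (hz : z ∈ U) : IsUnit (gUp F z).det :=
  (hF.posDef z hz).det_pos.ne'.isUnit

lemma gUp_mul_gLow {z : Phase n} (hz : z ∈ U) : gUp F z * gLow F z = 1 :=
  Matrix.mul_nonsing_inv _ (hF.isUnit_det_gUp hz)

lemma gLow_mul_gUp {z : Phase n} (hz : z ∈ U) : gLow F z * gUp F z = 1 :=
  Matrix.nonsing_inv_mul _ (hF.isUnit_det_gUp hz)

omit hF in
lemma contDiffOn_det {m : Type*} [Fintype m] [DecidableEq m] {A : Phase n → Matrix m m ℝ}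
    {U : Set (Phase n)} (hA : ∀ i j, ContDiffOn ℝ ∞ (fun z => A z i j) U) :
    ContDiffOn ℝ ∞ (fun z => (A z).det) U := by
  simp only [Matrix.det_apply]
  exact ContDiffOn.sum fun σ _ => (contDiffOn_prod fun i _ => hA _ _).const_smul _

/-- Cramer's rule: each entry of the inverse is a quotient of determinants that are smooth in the
entries of `gUp`. -/
lemma contDiffOn_gLow (i j : Fin n) : ContDiffOn ℝ ∞ (fun z => gLow F z i j) U := by
  have h1 : ∀ z, gLow F z i j
      = ((gUp F z).det)⁻¹ * ((gUp F z).updateRow j (Pi.single i 1)).det := by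
    intro z
    rw [gLow, Matrix.inv_def, Matrix.smul_apply, Matrix.adjugate_apply, Ring.inverse_eq_inv',
      smul_eq_mul]
  simp only [h1]
  refine ((contDiffOn_det hF.contDiffOn_gUp).inv fun z hz => (hF.isUnit_det_gUp hz).ne_zero).mul
    (contDiffOn_det fun a b => ?_)
  by_cases h : a = j
  · subst h
    simpa using contDiffOn_const
  · simpa [Matrix.updateRow_ne h] using hF.contDiffOn_gUp a b

lemma contDiffOn_nonlin (i j : Fin n) : ContDiffOn ℝ ∞ (nonlin F i j) U := by
  have hP := fun {f} (hf : ContDiffOn ℝ ∞ f U) k => contDiffOn_dP hF.isOpen hf k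
  have hX := fun {f} (hf : ContDiffOn ℝ ∞ f U) k => contDiffOn_dX hF.isOpen hf k
  have hs := hF.contDiffOn_sqF
  have hl := hF.contDiffOn_gLow
  refine (contDiffOn_const.mul (ContDiffOn.sum fun k _ => ?_)).sub
    (contDiffOn_const.mul (ContDiffOn.sum fun k _ => ?_))
  · exact ((hP (hl i j) k).mul (hX hs k)).sub ((hP hs k).mul (hX (hl i j) k))
  · exact ((hl i k).mul (hP (hX hs j) k)).add ((hl j k).mul (hP (hX hs i) k))

lemma gUp_transpose {z : Phase n} (hz : z ∈ U) : (gUp F z)ᵀ = gUp F z := by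
  have h := (hF.posDef z hz).1
  rwa [Matrix.IsHermitian, Matrix.conjTranspose_eq_transpose_of_trivial] at h

lemma gLow_transpose {z : Phase n} (hz : z ∈ U) : (gLow F z)ᵀ = gLow F z := by
  rw [gLow, Matrix.transpose_nonsing_inv, hF.gUp_transpose hz]

lemma dX_dP_comm {z : Phase n} (hz : z ∈ U) (i j : Fin n) :
    dX i (dP j (sqF F)) z = mixedHess F z j i :=
  fderiv_fderiv_apply_comm hF.isOpen hF.contDiffOn_sqF hz _ _

omit hF in
lemma dP_dP {z : Phase n} (i j : Fin n) : dP i (dP j (sqF F)) z = 2 * gUp F z i j := by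
  simp [gUp]

lemma baseHess_transpose {z : Phase n} (hz : z ∈ U) : (baseHess F z)ᵀ = baseHess F z := by
  ext i j
  exact fderiv_fderiv_apply_comm hF.isOpen hF.contDiffOn_sqF hz _ _

lemma matDeriv_gLow_transpose {z : Phase n} (hz : z ∈ U) (u : Phase n) :
    (matDeriv (gLow F) z u)ᵀ = matDeriv (gLow F) z u := by
  ext i j
  refine congrArg (fun T : Phase n →L[ℝ] ℝ => T u) (Filter.EventuallyEq.fderiv_eq ?_)
  filter_upwards [hF.isOpen.mem_nhds hz] with w hw
  exact congrFun (congrFun (hF.gLow_transpose hw) i) j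

omit hF in
/-- The canonical nonlinear connection in matrix form. -/
lemma nonlinMat_eq {z : Phase n} : nonlinMat F z = -(1 / 2 : ℝ) • matDeriv (gLow F) z (ham F z)
    - (1 / 4 : ℝ) • (gLow F z * mixedHess F z + (gLow F z * mixedHess F z)ᵀ) := by
  ext i j
  simp only [nonlinMat, nonlin, poisson_sqF, Matrix.of_apply, matDeriv, Matrix.sub_apply,
    Matrix.smul_apply, smul_eq_mul, Matrix.add_apply, Matrix.transpose_apply, Matrix.mul_apply,
    mixedHess, Finset.sum_add_distrib]
  ring

lemma nonlinMat_transpose {z : Phase n} (hz : z ∈ U) : (nonlinMat F z)ᵀ = nonlinMat F z := by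
  rw [nonlinMat_eq]
  simp only [Matrix.transpose_sub, Matrix.transpose_smul, hF.matDeriv_gLow_transpose hz,
    Matrix.transpose_add, Matrix.transpose_transpose]
  rw [add_comm (gLow F z * mixedHess F z)]

/-! ### Euler's relations -/

lemma sqF_homog {z : Phase n} (hz : z ∈ U) {t : ℝ} (ht : 0 < t) :
    sqF F (z.1, t • z.2) = t ^ 2 * sqF F z := by
  rw [sqF, hF.homog z hz t ht, sqF]; ring

lemma fderiv_sqF_mom {z : Phase n} (hz : z ∈ U) : fderiv ℝ (sqF F) z (0, z.2) = 2 * sqF F z := by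
  have h1 : HasDerivAt (fun t : ℝ => ((z.1, t • z.2) : Phase n)) (0, z.2) 1 := by
    simpa using (hasDerivAt_const (1 : ℝ) z.1).prodMk ((hasDerivAt_id (1 : ℝ)).smul_const z.2)
  have h2 : HasFDerivAt (sqF F) (fderiv ℝ (sqF F) z) ((z.1, (1 : ℝ) • z.2) : Phase n) := by
    rw [one_smul]
    exact (hF.contDiffOn_sqF.differentiableAt_of_isOpen hF.isOpen hz).hasFDerivAt
  have h3 := h2.comp_hasDerivAt (1 : ℝ) h1
  have h4 : HasDerivAt (fun t : ℝ => t ^ 2 * sqF F z) (2 * sqF F z) 1 := by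
    simpa using (hasDerivAt_pow 2 (1 : ℝ)).mul_const (sqF F z)
  refine h3.unique (h4.congr_of_eventuallyEq ?_)
  filter_upwards [lt_mem_nhds (zero_lt_one (α := ℝ))] with t ht
  exact hF.sqF_homog hz ht

lemma sum_mom_dP {z : Phase n} (hz : z ∈ U) : ∑ i, mom z i * dP i (sqF F) z = 2 * sqF F z := by
  rw [← hF.fderiv_sqF_mom hz, fderiv_eq_sum]
  simp [mom]

/-- The derivative of the Euler relation. -/
lemma fderiv_sum_mom_dP {z : Phase n} (hz : z ∈ U) (u : Phase n) :
    ∑ i, (mom z i * fderiv ℝ (dP i (sqF F)) z u + u.2 i * dP i (sqF F) z)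
      = 2 * fderiv ℝ (sqF F) z u := by
  have hm : ∀ i, HasFDerivAt (fun w : Phase n => mom w i)
      ((EuclideanSpace.proj i : EuclideanSpace ℝ (Fin n) →L[ℝ] ℝ).comp
        (ContinuousLinearMap.snd ℝ _ _)) z := fun i =>
    ((EuclideanSpace.proj i : EuclideanSpace ℝ (Fin n) →L[ℝ] ℝ).comp
        (ContinuousLinearMap.snd ℝ (EuclideanSpace ℝ (Fin n)) _)).hasFDerivAt
  have hd : ∀ i, HasFDerivAt (dP i (sqF F)) (fderiv ℝ (dP i (sqF F)) z) z := fun i =>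
    ((contDiffOn_dP hF.isOpen hF.contDiffOn_sqF i).differentiableAt_of_isOpen
      hF.isOpen hz).hasFDerivAt
  have h1 := HasFDerivAt.fun_sum (u := Finset.univ) fun i _ => (hm i).mul (hd i)
  have h2 : HasFDerivAt (fun w => 2 * sqF F w) ((2 : ℝ) • fderiv ℝ (sqF F) z) z :=
    (hF.contDiffOn_sqF.differentiableAt_of_isOpen hF.isOpen hz).hasFDerivAt.const_mul 2
  have h3 := h1.unique (h2.congr_of_eventuallyEq (by
    filter_upwards [hF.isOpen.mem_nhds hz] with w hw
    exact hF.sum_mom_dP hw))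
  have h4 := congrArg (fun T => T u) h3
  simpa [mul_comm] using h4

/-- The differentiated Euler relation in the direction `∂^i` reads `2 g^{ij} p_j + ∂^i K² = 2 ∂^i
K²`. -/
lemma dP_sqF {z : Phase n} (hz : z ∈ U) (i : Fin n) : dP i (sqF F) z = 2 * vel F z i := by
  have h := hF.fderiv_sum_mom_dP hz (eP i)
  have h1 : ∀ j, fderiv ℝ (dP j (sqF F)) z (eP i) = 2 * gUp F z i j := fun j => dP_dP i j
  simp only [h1, Finset.sum_add_distrib] at h
  simp only [eP, PiLp.single_apply, ite_mul, one_mul, zero_mul, Finset.sum_ite_eq',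
    Finset.mem_univ, if_true] at h
  have h2 : fderiv ℝ (sqF F) z (0, EuclideanSpace.single i 1) = dP i (sqF F) z := rfl
  rw [h2] at h
  have h3 : 2 * vel F z i = ∑ j, mom z j * (2 * gUp F z i j) := by
    rw [vel, Matrix.mulVec, dotProduct, Finset.mul_sum]
    exact Finset.sum_congr rfl fun j _ => by ring
  linarith

lemma mixedHess_transpose_mulVec_mom {z : Phase n} (hz : z ∈ U) (i : Fin n) :
    ((mixedHess F z)ᵀ *ᵥ mom z) i = 2 * dX i (sqF F) z := by
  have h := hF.fderiv_sum_mom_dP hz (eX i)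
  have h1 : ∀ j, fderiv ℝ (dP j (sqF F)) z (eX i) = mixedHess F z j i := hF.dX_dP_comm hz i
  simp only [h1] at h
  rw [dX, ← h, Matrix.mulVec, dotProduct]
  exact Finset.sum_congr rfl fun j _ => by simp [eX, mul_comm]

lemma mom_dotProduct_vel {z : Phase n} (hz : z ∈ U) : mom z ⬝ᵥ vel F z = F z ^ 2 := by
  have h := hF.sum_mom_dP hz
  simp only [hF.dP_sqF hz] at h
  have h2 : ∑ i, mom z i * (2 * vel F z i) = 2 * (mom z ⬝ᵥ vel F z) := by
    rw [dotProduct, Finset.mul_sum]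
    exact Finset.sum_congr rfl fun j _ => by ring
  rw [h2] at h
  simpa [sqF] using h

lemma gLow_mulVec_vel {z : Phase n} (hz : z ∈ U) : gLow F z *ᵥ vel F z = mom z := by
  rw [vel, Matrix.mulVec_mulVec, hF.gLow_mul_gUp hz, Matrix.one_mulVec]

end IsLocalCartan

end CartanGeom

/-! ### Passage from the manifold to induced coordinates. -/

namespace CartanGeom

variable {n : ℕ} {M : Type*} [TopologicalSpace M] [ChartedSpace (EuclideanSpace ℝ (Fin n)) M]
  [IsManifold (𝓡 n) ∞ M]

omit [ChartedSpace (EuclideanSpace ℝ (Fin n)) M] [IsManifold (𝓡 n) ∞ M] in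
lemma isOpen_slit (φ : OpenPartialHomeomorph M (EuclideanSpace ℝ (Fin n))) : IsOpen (slit φ) :=
  (φ.open_target.preimage continuous_fst).inter (isOpen_ne.preimage continuous_snd)

/-- The differentials of `φ` and `φ.symm` are mutually inverse, so evaluating the covector on the
image of the `j`-th basis vector returns `p_j`. -/
lemma covectorAt_snd_ne_zero {φ : OpenPartialHomeomorph M (EuclideanSpace ℝ (Fin n))}
    (hφ : φ ∈ IsManifold.maximalAtlas (𝓡 n) ∞ M) {z : Phase n} (hz : z ∈ slit φ) :
    (covectorAt φ z).2 ≠ 0 := by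
  obtain ⟨hz1, hz2⟩ := hz
  intro h
  apply hz2
  have hs : MDifferentiableAt (𝓡 n) (𝓡 n) φ.symm z.1 :=
    ((contMDiffOn_symm_of_mem_maximalAtlas hφ).contMDiffAt
      (φ.open_target.mem_nhds hz1)).mdifferentiableAt (by simp)
  have hd : MDifferentiableAt (𝓡 n) (𝓡 n) φ (φ.symm z.1) :=
    ((contMDiffOn_of_mem_maximalAtlas hφ).contMDiffAt
      (φ.open_source.mem_nhds (φ.map_target hz1))).mdifferentiableAt (by simp)
  have hcomp : (mfderiv (𝓡 n) (𝓡 n) φ (φ.symm z.1)).comp (mfderiv (𝓡 n) (𝓡 n) φ.symm z.1)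
      = ContinuousLinearMap.id ℝ _ := by
    rw [← mfderiv_comp _ hd hs, ← mfderiv_id]
    apply Filter.EventuallyEq.mfderiv_eq
    filter_upwards [φ.open_target.mem_nhds hz1] with w hw
    exact φ.right_inv hw
  ext j
  have h1 := congrArg (fun (T : TangentSpace (𝓡 n) (φ.symm z.1) →L[ℝ] ℝ) =>
    T (mfderiv (𝓡 n) (𝓡 n) φ.symm z.1 (EuclideanSpace.single j (1:ℝ)))) h
  have h2 : mfderiv (𝓡 n) (𝓡 n) φ (φ.symm z.1)
    (mfderiv (𝓡 n) (𝓡 n) φ.symm z.1 (EuclideanSpace.single j (1:ℝ)))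
      = (EuclideanSpace.single j (1:ℝ) : EuclideanSpace ℝ (Fin n)) :=
    congrArg (fun T : EuclideanSpace ℝ (Fin n) →L[ℝ] EuclideanSpace ℝ (Fin n) =>
      T (EuclideanSpace.single j (1:ℝ))) hcomp
  simp only [covectorAt] at h1
  have h3 : ∑ i, z.2 i * (EuclideanSpace.proj i : EuclideanSpace ℝ (Fin n) →L[ℝ] ℝ)
    (mfderiv (𝓡 n) (𝓡 n) φ (φ.symm z.1)
      (mfderiv (𝓡 n) (𝓡 n) φ.symm z.1 (EuclideanSpace.single j (1:ℝ)))) = 0 := by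
    refine Eq.trans ?_ h1
    erw [sum_apply]
    rfl
  rw [h2] at h3
  simpa [Pi.single_apply] using h3

/-- Smoothness into the bundle of homomorphisms is tested in its trivialization, where the covector
is a combination, with coefficients `p_i`, of components of the smooth differential of `φ`. -/
lemma contMDiffOn_covectorAt {φ : OpenPartialHomeomorph M (EuclideanSpace ℝ (Fin n))}
    (hφ : φ ∈ IsManifold.maximalAtlas (𝓡 n) ∞ M) :
    ContMDiffOn 𝓘(ℝ, Phase n) ((𝓡 n).prod 𝓘(ℝ, EuclideanSpace ℝ (Fin n) →L[ℝ] ℝ)) ∞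
      (covectorAt φ) (slit φ) := by
  intro z hz
  apply ContMDiffAt.contMDiffWithinAt
  have hbase : ContMDiffAt 𝓘(ℝ, Phase n) (𝓡 n) ∞ (fun w : Phase n => φ.symm w.1) z :=
    ((contMDiffOn_symm_of_mem_maximalAtlas hφ).contMDiffAt
      (φ.open_target.mem_nhds hz.1)).comp z contDiff_fst.contMDiff.contMDiffAt
  have hd : ContMDiffAt (𝓡 n) (𝓡 n) ∞ φ (φ.symm z.1) :=
    (contMDiffOn_of_mem_maximalAtlas hφ).contMDiffAt
      (φ.open_source.mem_nhds (φ.map_target hz.1))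
  have hD := (hd.mfderiv_const (m := ∞) (by simp)).comp (f := fun w : Phase n => φ.symm w.1) z hbase
  rw [contMDiffAt_hom_bundle]
  refine ⟨hbase, ?_⟩
  rw [contMDiffAt_iff_contDiffAt]
  have hD' := contMDiffAt_iff_contDiffAt.1 hD
  have : ContDiffAt ℝ ∞ (fun w : Phase n => ∑ i, w.2 i •
      ((EuclideanSpace.proj i : EuclideanSpace ℝ (Fin n) →L[ℝ] ℝ).comp
       (inTangentCoordinates (𝓡 n) (𝓡 n) id φ (mfderiv (𝓡 n) (𝓡 n) φ) (φ.symm z.1)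
        (φ.symm w.1)))) z := by
    refine ContDiffAt.sum fun i _ => ?_
    have h2 : ContDiffAt ℝ ∞ (fun w : Phase n => w.2 i) z := by fun_prop
    exact h2.smul (contDiffAt_const.clm_comp hD')
  convert this using 2 with w
  simp only [covectorAt, inTangentCoordinates]
  ext v
  simp [ContinuousLinearMap.inCoordinates]
  rfl

lemma CartanSpace.isLocalCartan_localK (S : CartanSpace n M)
    {φ : OpenPartialHomeomorph M (EuclideanSpace ℝ (Fin n))}
    (hφ : φ ∈ IsManifold.maximalAtlas (𝓡 n) ∞ M) : IsLocalCartan (S.localK φ) (slit φ) where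
  isOpen := isOpen_slit φ
  smooth := contMDiffOn_iff_contDiffOn.1
    (S.smooth_K.comp (contMDiffOn_covectorAt hφ) fun _ hz => covectorAt_snd_ne_zero hφ hz)
  cone _ hz _ ht := ⟨hz.1, smul_ne_zero ht.ne' hz.2⟩
  pos _ hz := S.pos_K _ (covectorAt_snd_ne_zero hφ hz)
  homog z _ t ht := by
    have h := S.homog_K (φ.symm z.1) (covectorAt φ z).2 t ht
    refine Eq.trans ?_ h
    refine congrArg (fun p : TangentSpace (𝓡 n) (φ.symm z.1) →L[ℝ] ℝ => S.K ⟨φ.symm z.1, p⟩) ?_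
    simp [covectorAt, Finset.smul_sum, smul_smul]
  posDef z hz := S.posDef_K φ hφ z hz

end CartanGeom

/-! ### Matrix calculus, the horizontality of `ξ`, and the curvature. -/

namespace CartanGeom

variable {n : ℕ}

open Matrix

/-- The componentwise derivative of a vector valued function. -/
def vecDeriv (y : Phase n → Fin n → ℝ) (z u : Phase n) : Fin n → ℝ :=
  fun i => fderiv ℝ (fun w => y w i) z u

lemma vecDeriv_congr {y y' : Phase n → Fin n → ℝ} {U : Set (Phase n)} (hU : IsOpen U)
    (h : ∀ w ∈ U, y w = y' w) {z : Phase n} (hz : z ∈ U) (u : Phase n) :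
    vecDeriv y z u = vecDeriv y' z u := by
  ext i
  refine congrArg (fun T : Phase n →L[ℝ] ℝ => T u) (Filter.EventuallyEq.fderiv_eq ?_)
  filter_upwards [hU.mem_nhds hz] with w hw
  rw [h w hw]

lemma matDeriv_congr {A B : Phase n → Matrix (Fin n) (Fin n) ℝ} {U : Set (Phase n)}
    (hU : IsOpen U) (h : ∀ w ∈ U, A w = B w) {z : Phase n} (hz : z ∈ U) (u : Phase n) :
    matDeriv A z u = matDeriv B z u := by
  ext i j
  refine congrArg (fun T : Phase n →L[ℝ] ℝ => T u) (Filter.EventuallyEq.fderiv_eq ?_)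
  filter_upwards [hU.mem_nhds hz] with w hw
  rw [h w hw]

lemma fderiv_sum_mul {ι : Type*} [Fintype ι] {f h : ι → Phase n → ℝ} {z : Phase n}
    (hf : ∀ k, DifferentiableAt ℝ (f k) z) (hh : ∀ k, DifferentiableAt ℝ (h k) z) (u : Phase n) :
    fderiv ℝ (fun w => ∑ k, f k w * h k w) z u
      = ∑ k, fderiv ℝ (f k) z u * h k z + ∑ k, f k z * fderiv ℝ (h k) z u := by
  have h1 := HasFDerivAt.fun_sum (u := Finset.univ) fun k _ =>
    (hf k).hasFDerivAt.mul (hh k).hasFDerivAt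
  refine (congrArg (fun T : Phase n →L[ℝ] ℝ => T u) h1.fderiv).trans ?_
  simp [Finset.sum_add_distrib, mul_comm, add_comm]

lemma vecDeriv_mulVec {A : Phase n → Matrix (Fin n) (Fin n) ℝ} {y : Phase n → Fin n → ℝ}
    {z : Phase n} (hA : ∀ i j, DifferentiableAt ℝ (fun w => A w i j) z)
    (hy : ∀ i, DifferentiableAt ℝ (fun w => y w i) z) (u : Phase n) :
    vecDeriv (fun w => A w *ᵥ y w) z u = matDeriv A z u *ᵥ y z + A z *ᵥ vecDeriv y z u := by
  ext i
  exact fderiv_sum_mul (hA i) hy u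

lemma matDeriv_mul {A B : Phase n → Matrix (Fin n) (Fin n) ℝ}
    {z : Phase n} (hA : ∀ i j, DifferentiableAt ℝ (fun w => A w i j) z)
    (hB : ∀ i j, DifferentiableAt ℝ (fun w => B w i j) z) (u : Phase n) :
    matDeriv (fun w => A w * B w) z u = matDeriv A z u * B z + A z * matDeriv B z u := by
  ext i j
  have := fderiv_sum_mul (hA i) (fun k => hB k j) u
  simpa only [matDeriv, Matrix.of_apply, Matrix.mul_apply, Matrix.add_apply] using this

lemma vecDeriv_mom (z u : Phase n) : vecDeriv mom z u = mom u := by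
  ext i
  exact congrArg (fun T : Phase n →L[ℝ] ℝ => T u)
    ((EuclideanSpace.proj i : EuclideanSpace ℝ (Fin n) →L[ℝ] ℝ).comp
      (ContinuousLinearMap.snd ℝ (EuclideanSpace ℝ (Fin n)) _)).fderiv

/-- The base components of a tangent vector. -/
def base (v : Phase n) : Fin n → ℝ := v.1.ofLp

/-- The vector `∂K²/∂x^i`. -/
def baseGrad (F : Phase n → ℝ) (z : Phase n) : Fin n → ℝ := fun i => dX i (sqF F) z

/-- The vertical components `δp_i(v)`. -/
def vert (F : Phase n → ℝ) (z v : Phase n) : Fin n → ℝ := mom v - nonlinMat F z *ᵥ base v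

/-- The symmetric matrix `S_{ij}` with `(δN_{jk}/δx^i) p^k = S_{ij}`. -/
def dNonlinVel (F : Phase n → ℝ) (z : Phase n) : Matrix (Fin n) (Fin n) ℝ :=
  -((1 / 2 : ℝ) • baseHess F z + (1 / 2 : ℝ) • ((mixedHess F z)ᵀ * nonlinMat F z)
    + (1 / 2 : ℝ) • (nonlinMat F z * mixedHess F z) + nonlinMat F z * gUp F z * nonlinMat F z)

lemma sum_smul_eDelta (F : Phase n → ℝ) (z : Phase n) (a : Fin n → ℝ) :
    ∑ i, a i • eDelta F i z = (WithLp.toLp 2 a, WithLp.toLp 2 (a ᵥ* nonlinMat F z)) := by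
  ext j <;> simp [eDelta, eX, eP, Prod.fst_sum, Prod.snd_sum, Pi.single_apply, vecMul, dotProduct,
    nonlinMat]

lemma sasaki_eq (F : Phase n → ℝ) (z v w : Phase n) :
    sasaki F z v w = base v ⬝ᵥ (gLow F z *ᵥ base w) + vert F z v ⬝ᵥ (gUp F z *ᵥ vert F z w) := by
  have h : ∀ u i, vert F z u i = deltaP F i z u := fun u i => rfl
  simp only [sasaki, dotProduct, mulVec, Finset.mul_sum, h]
  refine congrArg₂ (· + ·) ?_ ?_ <;>
  refine Finset.sum_congr rfl fun i _ => Finset.sum_congr rfl fun j _ => ?_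
  · simp only [base]; ring
  · ring

namespace IsLocalCartan

variable {F : Phase n → ℝ} {U : Set (Phase n)} (hF : IsLocalCartan F U)
include hF

lemma base_ham {z : Phase n} (hz : z ∈ U) : base (ham F z) = vel F z := by
  ext i
  simp [base, ham, hF.dP_sqF hz]

omit hF in
lemma mom_ham (z : Phase n) : mom (ham F z) = -(1 / 2 : ℝ) • baseGrad F z := by
  ext i
  simp [mom, ham, baseGrad]

lemma vel_eq {z : Phase n} (hz : z ∈ U) (i : Fin n) :
    vel F z i = (1 / 2 : ℝ) * dP i (sqF F) z := by
  rw [hF.dP_sqF hz]; ring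

lemma contDiffOn_vel (i : Fin n) : ContDiffOn ℝ ∞ (fun z => vel F z i) U :=
  (contDiffOn_const.mul (contDiffOn_dP hF.isOpen hF.contDiffOn_sqF i)).congr
    fun _ hz => hF.vel_eq hz i

lemma gUp_comm {z : Phase n} (hz : z ∈ U) (i j : Fin n) : gUp F z i j = gUp F z j i :=
  congrFun (congrFun (hF.gUp_transpose hz) j) i

lemma vecDeriv_vel {z : Phase n} (hz : z ∈ U) (u : Phase n) :
    vecDeriv (vel F) z u = (1 / 2 : ℝ) • (mixedHess F z *ᵥ base u) + gUp F z *ᵥ mom u := by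
  rw [vecDeriv_congr hF.isOpen (y' := fun w i => (1 / 2 : ℝ) * dP i (sqF F) w)
    (fun w hw => funext fun i => hF.vel_eq hw i) hz]
  ext i
  have hd := (contDiffOn_dP hF.isOpen hF.contDiffOn_sqF i).differentiableAt_of_isOpen
      hF.isOpen hz
  simp only [vecDeriv, fderiv_const_mul hd]
  rw [_root_.smul_apply, fderiv_eq_sum]
  simp only [hF.dX_dP_comm hz, dP_dP, Pi.add_apply, Pi.smul_apply, mulVec, dotProduct, smul_eq_mul]
  rw [mul_add, Finset.mul_sum (s := Finset.univ) (f := fun k => u.2 k * (2 * gUp F z k i))]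
  refine congrArg₂ (· + ·) (congrArg _ (Finset.sum_congr rfl fun j _ => mul_comm _ _))
    (Finset.sum_congr rfl fun j _ => ?_)
  rw [hF.gUp_comm hz i j]
  simp only [mom]; ring

lemma vecDeriv_baseGrad {z : Phase n} (hz : z ∈ U) (u : Phase n) :
    vecDeriv (baseGrad F) z u = baseHess F z *ᵥ base u + (mixedHess F z)ᵀ *ᵥ mom u := by
  ext i
  simp only [vecDeriv, baseGrad]
  rw [fderiv_eq_sum, ← hF.baseHess_transpose hz]
  exact congrArg₂ (· + ·) (Finset.sum_congr rfl fun j _ => mul_comm _ _)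
    (Finset.sum_congr rfl fun j _ => mul_comm _ _)

lemma differentiableAt_gLow {z : Phase n} (hz : z ∈ U) (i j : Fin n) :
    DifferentiableAt ℝ (fun w => gLow F w i j) z :=
  (hF.contDiffOn_gLow i j).differentiableAt_of_isOpen hF.isOpen hz

lemma differentiableAt_gUp {z : Phase n} (hz : z ∈ U) (i j : Fin n) :
    DifferentiableAt ℝ (fun w => gUp F w i j) z :=
  (hF.contDiffOn_gUp i j).differentiableAt_of_isOpen hF.isOpen hz

lemma differentiableAt_vel {z : Phase n} (hz : z ∈ U) (i : Fin n) :
    DifferentiableAt ℝ (fun w => vel F w i) z :=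
  (hF.contDiffOn_vel i).differentiableAt_of_isOpen hF.isOpen hz

lemma differentiableAt_nonlin {z : Phase n} (hz : z ∈ U) (i j : Fin n) :
    DifferentiableAt ℝ (fun w => nonlinMat F w i j) z :=
  (hF.contDiffOn_nonlin i j).differentiableAt_of_isOpen hF.isOpen hz

lemma transpose_mixedHess_mulVec_mom {z : Phase n} (hz : z ∈ U) :
    (mixedHess F z)ᵀ *ᵥ mom z = (2 : ℝ) • baseGrad F z :=
  funext (hF.mixedHess_transpose_mulVec_mom hz)

/-- Differentiating `g_{ij} p^j = p_i` along the Hamiltonian field expresses the derivative of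
`g_{ij}`, contracted with `p^j`, through the mixed Hessian. In the formula for `N` the mixed Hessian
terms in `p^j` then cancel, and Euler's relation evaluates the transposed one. -/
lemma nonlinMat_mulVec_vel {z : Phase n} (hz : z ∈ U) :
    nonlinMat F z *ᵥ vel F z = -(1 / 2 : ℝ) • baseGrad F z := by
  have h1 := vecDeriv_mulVec (hF.differentiableAt_gLow hz) (hF.differentiableAt_vel hz) (ham F z)
  rw [vecDeriv_congr hF.isOpen (y' := mom) (fun w hw => hF.gLow_mulVec_vel hw) hz, vecDeriv_mom,
    hF.vecDeriv_vel hz, hF.base_ham hz, mom_ham, mulVec_add, mulVec_smul, mulVec_smul, mulVec_smul,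
    mulVec_mulVec, mulVec_mulVec, hF.gLow_mul_gUp hz, one_mulVec] at h1
  rw [nonlinMat_eq, sub_mulVec, smul_mulVec, smul_mulVec, add_mulVec, transpose_mul,
    hF.gLow_transpose hz, ← mulVec_mulVec _ (mixedHess F z)ᵀ, hF.gLow_mulVec_vel hz,
    hF.transpose_mixedHess_mulVec_mom hz]
  ext i
  have h2 := congrFun h1 i
  simp only [Pi.add_apply, Pi.sub_apply, Pi.smul_apply, smul_eq_mul] at h2 ⊢
  linarith

/-- `C*` is vertical with components `p_i`, so `J` sends it to the horizontal lift of `p^i`, whose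
momentum part is `N_{ij} p^j`. -/
lemma xi_eq_ham {z : Phase n} (hz : z ∈ U) : xi F z = ham F z := by
  have h1 : liouville z = (0, z.2) := by
    have := sum_eX_add_sum_eP ((0, z.2) : Phase n)
    simpa [liouville] using this
  have h2 : ∀ i, deltaP F i z (liouville z) = z.2 i := by
    intro i; rw [h1]; simp [deltaP]
  have h3 : xi F z = ∑ j, vel F z j • eDelta F j z := by
    rw [xi, almostJ]
    simp only [h2]
    simp only [h1, PiLp.zero_apply, mul_zero, zero_smul, Finset.sum_const_zero, sub_zero]
    rw [Finset.sum_comm]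
    refine Finset.sum_congr rfl fun j _ => ?_
    rw [← Finset.sum_smul]
    congr 1
    exact Finset.sum_congr rfl fun k _ => congrArg (· * mom z k) (hF.gUp_comm hz k j)
  rw [h3, sum_smul_eDelta, ← mulVec_transpose, hF.nonlinMat_transpose hz,
    hF.nonlinMat_mulVec_vel hz, ← hF.base_ham hz, ← mom_ham]
  rfl

/-- The definition of `N` solved for the derivative of the metric along `ξ`. This is what makes the
diagonal blocks of the Lie derivative cancel. -/
lemma matDeriv_gLow_ham {z : Phase n} (hz : z ∈ U) : matDeriv (gLow F) z (ham F z)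
    = -(2 : ℝ) • nonlinMat F z
      - (1 / 2 : ℝ) • (gLow F z * mixedHess F z + (mixedHess F z)ᵀ * gLow F z) := by
  have h := nonlinMat_eq (F := F) (z := z)
  rw [transpose_mul, hF.gLow_transpose hz] at h
  rw [h]
  module

lemma matDeriv_gUp {z : Phase n} (hz : z ∈ U) (u : Phase n) : matDeriv (gUp F) z u
    = -(gUp F z * matDeriv (gLow F) z u * gUp F z) := by
  have h1 := matDeriv_mul (hF.differentiableAt_gUp hz) (hF.differentiableAt_gLow hz) u
  rw [matDeriv_congr hF.isOpen (B := fun _ => 1) (fun w hw => hF.gUp_mul_gLow hw) hz] at h1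
  have h2 : matDeriv (fun _ : Phase n => (1 : Matrix (Fin n) (Fin n) ℝ)) z u = 0 := by
    ext i j; simp [matDeriv]
  rw [h2] at h1
  have h3 := congrArg (· * gUp F z) h1
  simp only [add_mul, zero_mul, Matrix.mul_assoc, hF.gLow_mul_gUp hz, Matrix.mul_one] at h3
  rw [Matrix.mul_assoc]
  exact eq_neg_of_add_eq_zero_left h3.symm

lemma matDeriv_gUp_ham {z : Phase n} (hz : z ∈ U) : matDeriv (gUp F) z (ham F z)
    = (2 : ℝ) • (gUp F z * nonlinMat F z * gUp F z)
      + (1 / 2 : ℝ) • (mixedHess F z * gUp F z + gUp F z * (mixedHess F z)ᵀ) := by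
  rw [hF.matDeriv_gUp hz, hF.matDeriv_gLow_ham hz]
  have h1 : gUp F z * (gLow F z * mixedHess F z) * gUp F z = mixedHess F z * gUp F z := by
    rw [← Matrix.mul_assoc, hF.gUp_mul_gLow hz, Matrix.one_mul]
  have h2 : gUp F z * ((mixedHess F z)ᵀ * gLow F z) * gUp F z = gUp F z * (mixedHess F z)ᵀ := by
    rw [Matrix.mul_assoc, Matrix.mul_assoc, hF.gLow_mul_gUp hz, Matrix.mul_one]
  simp only [Matrix.mul_sub, Matrix.sub_mul, Matrix.mul_smul, Matrix.smul_mul, Matrix.mul_add,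
    Matrix.add_mul, h1, h2]
  module

/-! ### The curvature -/

lemma dNonlinVel_transpose {z : Phase n} (hz : z ∈ U) :
    (dNonlinVel F z)ᵀ = dNonlinVel F z := by
  simp only [dNonlinVel, transpose_neg, transpose_add, transpose_smul, transpose_mul,
    transpose_transpose, hF.nonlinMat_transpose hz, hF.gUp_transpose hz, hF.baseHess_transpose hz,
    Matrix.mul_assoc]
  module

/-- Obtained by differentiating `N_{ij} p^j = -½ ∂K²/∂x^i` in the direction `u`. Splitting `u` into
horizontal and vertical parts isolates the symmetric matrix `dNonlinVel`; no third derivatives of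
`K²` remain. -/
lemma matDeriv_nonlinMat_mulVec_vel {z : Phase n} (hz : z ∈ U) (u : Phase n) :
    matDeriv (nonlinMat F) z u *ᵥ vel F z = dNonlinVel F z *ᵥ base u
      - ((1 / 2 : ℝ) • (mixedHess F z)ᵀ + nonlinMat F z * gUp F z) *ᵥ vert F z u := by
  have h1 := vecDeriv_mulVec (hF.differentiableAt_nonlin hz) (hF.differentiableAt_vel hz) u
  have h2 : vecDeriv (fun w => -(1 / 2 : ℝ) • baseGrad F w) z u
      = -(1 / 2 : ℝ) • vecDeriv (baseGrad F) z u := by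
    ext i
    have hd : DifferentiableAt ℝ (fun w => baseGrad F w i) z :=
      (contDiffOn_dX hF.isOpen hF.contDiffOn_sqF i).differentiableAt_of_isOpen hF.isOpen hz
    simp only [vecDeriv, Pi.smul_apply, smul_eq_mul, fderiv_const_mul hd]
    rfl
  rw [vecDeriv_congr hF.isOpen (fun w hw => hF.nonlinMat_mulVec_vel hw) hz, h2,
    hF.vecDeriv_baseGrad hz, hF.vecDeriv_vel hz] at h1
  rw [← sub_eq_iff_eq_add] at h1
  rw [← h1]
  have h3 : mom u = vert F z u + nonlinMat F z *ᵥ base u := by simp [vert]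
  rw [h3]
  simp only [dNonlinVel, mulVec_add, mulVec_smul, add_mulVec, smul_mulVec, neg_mulVec,
    ← mulVec_mulVec]
  module

/-- Contracting `R_{ikj}` with `p^k`: in the first term `p^k` meets an index of `N`, which gives
`dNonlinVel`; in the second it meets the direction of differentiation, and `p^k δ/δx^k` is the
Hamiltonian field. -/
lemma curv2_eq {z : Phase n} (hz : z ∈ U) (i j : Fin n) : curv2 F i j z
    = (dNonlinVel F z - matDeriv (nonlinMat F) z (ham F z)) i j := by
  have h1 : curv2 F i j z = ∑ k, vel F z k * curv3 F i k j z := by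
    rw [curv2, Finset.sum_comm]
    refine Finset.sum_congr rfl fun k _ => ?_
    rw [← Finset.sum_mul]
    congr 1
    refine Finset.sum_congr rfl fun h _ => ?_
    rw [hF.gUp_comm hz h k, mul_comm]
    rfl
  have h2 : ∑ k, vel F z k * dDelta F i (nonlin F k j) z = dNonlinVel F z i j := by
    have h := congrFun (hF.matDeriv_nonlinMat_mulVec_vel hz (eDelta F i z)) j
    -- Writing `δ/δx^i` as a combination of the horizontal frame lets `sum_smul_eDelta` read off its
    -- components; its vertical part is then zero.
    have he : eDelta F i z = ∑ k, (Pi.single i 1 : Fin n → ℝ) k • eDelta F k z := by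
      simp [Pi.single_apply]
    have hb : base (eDelta F i z) = Pi.single i 1 := by rw [he, sum_smul_eDelta]; rfl
    have hm : mom (eDelta F i z) = nonlinMat F z *ᵥ Pi.single i 1 := by
      rw [he, sum_smul_eDelta, ← hF.nonlinMat_transpose hz, mulVec_transpose,
        hF.nonlinMat_transpose hz]; rfl
    rw [vert, hb, hm, sub_self, mulVec_zero, sub_zero, mulVec_single_one] at h
    rw [← hF.dNonlinVel_transpose hz]
    refine Eq.trans ?_ h
    refine Finset.sum_congr rfl fun k _ => ?_
    rw [mul_comm]
    congr 1
    refine congrArg (fun T : Phase n →L[ℝ] ℝ => T (eDelta F i z)) (Filter.EventuallyEq.fderiv_eq ?_)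
    filter_upwards [hF.isOpen.mem_nhds hz] with w hw
    exact congrFun (congrFun (hF.nonlinMat_transpose hw) j) k
  have h3 : ∑ k, vel F z k * dDelta F k (nonlin F i j) z
      = matDeriv (nonlinMat F) z (ham F z) i j := by
    have hh : ham F z = ∑ k, vel F z k • eDelta F k z := by
      rw [sum_smul_eDelta, ← mulVec_transpose, hF.nonlinMat_transpose hz,
        hF.nonlinMat_mulVec_vel hz, ← hF.base_ham hz, ← mom_ham]; rfl
    rw [hh]
    simp only [matDeriv, Matrix.of_apply, map_sum, map_smul, smul_eq_mul]
    rfl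
  rw [h1, Matrix.sub_apply, ← h2, ← h3, ← Finset.sum_sub_distrib]
  exact Finset.sum_congr rfl fun k _ => by rw [curv3]; ring

end IsLocalCartan

end CartanGeom

namespace CartanGeom

variable {n : ℕ}

open Matrix

/-! ### The derivative of the Sasaki lift -/

lemma base_fderiv {Y : Phase n → Phase n} {z : Phase n} (hY : DifferentiableAt ℝ Y z)
    (u : Phase n) : base (fderiv ℝ Y z u) = vecDeriv (fun w => base (Y w)) z u := by
  ext i
  have h := (((EuclideanSpace.proj i : EuclideanSpace ℝ (Fin n) →L[ℝ] ℝ).comp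
    (ContinuousLinearMap.fst ℝ _ (EuclideanSpace ℝ (Fin n)))).hasFDerivAt (x := Y z)).comp z
      hY.hasFDerivAt
  exact (congrArg (fun T : Phase n →L[ℝ] ℝ => T u) h.fderiv).symm

lemma mom_fderiv {Y : Phase n → Phase n} {z : Phase n} (hY : DifferentiableAt ℝ Y z)
    (u : Phase n) : mom (fderiv ℝ Y z u) = vecDeriv (fun w => mom (Y w)) z u := by
  ext i
  have h := (((EuclideanSpace.proj i : EuclideanSpace ℝ (Fin n) →L[ℝ] ℝ).comp
    (ContinuousLinearMap.snd ℝ (EuclideanSpace ℝ (Fin n)) _)).hasFDerivAt (x := Y z)).comp z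
      hY.hasFDerivAt
  exact (congrArg (fun T : Phase n →L[ℝ] ℝ => T u) h.fderiv).symm

lemma differentiableAt_base {Y : Phase n → Phase n} {z : Phase n} (hY : DifferentiableAt ℝ Y z)
    (i : Fin n) : DifferentiableAt ℝ (fun w => base (Y w) i) z :=
  (((EuclideanSpace.proj i : EuclideanSpace ℝ (Fin n) →L[ℝ] ℝ).comp
    (ContinuousLinearMap.fst ℝ _ (EuclideanSpace ℝ (Fin n)))).differentiableAt (x := Y z)).comp z hY

lemma differentiableAt_mom {Y : Phase n → Phase n} {z : Phase n} (hY : DifferentiableAt ℝ Y z)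
    (i : Fin n) : DifferentiableAt ℝ (fun w => mom (Y w) i) z :=
  (((EuclideanSpace.proj i : EuclideanSpace ℝ (Fin n) →L[ℝ] ℝ).comp
    (ContinuousLinearMap.snd ℝ (EuclideanSpace ℝ (Fin n)) _)).differentiableAt (x := Y z)).comp z hY

lemma differentiableAt_mulVec {A : Phase n → Matrix (Fin n) (Fin n) ℝ} {y : Phase n → Fin n → ℝ}
    {z : Phase n} (hA : ∀ i j, DifferentiableAt ℝ (fun w => A w i j) z)
    (hy : ∀ i, DifferentiableAt ℝ (fun w => y w i) z) (i : Fin n) :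
    DifferentiableAt ℝ (fun w => (A w *ᵥ y w) i) z :=
  DifferentiableAt.fun_sum (u := Finset.univ) fun k _ => (hA i k).fun_mul (hy k)

lemma differentiableAt_dotProduct {x y : Phase n → Fin n → ℝ} {z : Phase n}
    (hx : ∀ i, DifferentiableAt ℝ (fun w => x w i) z)
    (hy : ∀ i, DifferentiableAt ℝ (fun w => y w i) z) :
    DifferentiableAt ℝ (fun w => x w ⬝ᵥ y w) z :=
  DifferentiableAt.fun_sum (u := Finset.univ) fun k _ => (hx k).fun_mul (hy k)

lemma fderiv_dotProduct_mulVec {A : Phase n → Matrix (Fin n) (Fin n) ℝ}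
    {x y : Phase n → Fin n → ℝ} {z : Phase n}
    (hA : ∀ i j, DifferentiableAt ℝ (fun w => A w i j) z)
    (hx : ∀ i, DifferentiableAt ℝ (fun w => x w i) z)
    (hy : ∀ i, DifferentiableAt ℝ (fun w => y w i) z) (u : Phase n) :
    fderiv ℝ (fun w => x w ⬝ᵥ (A w *ᵥ y w)) z u = vecDeriv x z u ⬝ᵥ (A z *ᵥ y z)
      + x z ⬝ᵥ (matDeriv A z u *ᵥ y z) + x z ⬝ᵥ (A z *ᵥ vecDeriv y z u) := by
  rw [add_assoc, ← dotProduct_add, ← vecDeriv_mulVec hA hy]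
  exact fderiv_sum_mul hx (differentiableAt_mulVec hA hy) u

/-- The derivative of `G(v, w)` in the direction `u`, for constant `v` and `w`. -/
def sasakiDeriv (F : Phase n → ℝ) (z u v w : Phase n) : ℝ :=
  base v ⬝ᵥ (matDeriv (gLow F) z u *ᵥ base w) + vert F z v ⬝ᵥ (matDeriv (gUp F) z u *ᵥ vert F z w)
    - (matDeriv (nonlinMat F) z u *ᵥ base v) ⬝ᵥ (gUp F z *ᵥ vert F z w)
    - vert F z v ⬝ᵥ (gUp F z *ᵥ (matDeriv (nonlinMat F) z u *ᵥ base w))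

lemma base_add (v w : Phase n) : base (v + w) = base v + base w := rfl
lemma mom_add (v w : Phase n) : mom (v + w) = mom v + mom w := rfl
lemma base_smul (c : ℝ) (v : Phase n) : base (c • v) = c • base v := rfl
lemma mom_smul (c : ℝ) (v : Phase n) : mom (c • v) = c • mom v := rfl

lemma vert_add (F : Phase n → ℝ) (z v w : Phase n) :
    vert F z (v + w) = vert F z v + vert F z w := by
  simp only [vert, base_add, mom_add, mulVec_add]; abel

lemma vert_smul (F : Phase n → ℝ) (z : Phase n) (c : ℝ) (v : Phase n) :
    vert F z (c • v) = c • vert F z v := by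
  simp only [vert, base_smul, mom_smul, mulVec_smul, smul_sub]

lemma isLinearMap_sasaki_left (F : Phase n → ℝ) (z w : Phase n) :
    IsLinearMap ℝ (fun v => sasaki F z v w) where
  map_add v v' := by
    simp only [sasaki_eq, base_add, vert_add, add_dotProduct]; ring
  map_smul c v := by
    simp only [sasaki_eq, base_smul, vert_smul, smul_dotProduct, smul_eq_mul]; ring

lemma isLinearMap_sasaki_right (F : Phase n → ℝ) (z v : Phase n) :
    IsLinearMap ℝ (sasaki F z v) where
  map_add w w' := by
    simp only [sasaki_eq, base_add, vert_add, mulVec_add, dotProduct_add]; ring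
  map_smul c w := by
    simp only [sasaki_eq, base_smul, vert_smul, mulVec_smul, dotProduct_smul, smul_eq_mul]; ring

lemma isLinearMap_sasakiDeriv_mid (F : Phase n → ℝ) (z u w : Phase n) :
    IsLinearMap ℝ (fun v => sasakiDeriv F z u v w) where
  map_add v v' := by
    simp only [sasakiDeriv, base_add, vert_add, mulVec_add, add_dotProduct]; ring
  map_smul c v := by
    simp only [sasakiDeriv, base_smul, vert_smul, mulVec_smul, smul_dotProduct, smul_eq_mul]; ring

lemma isLinearMap_sasakiDeriv_right (F : Phase n → ℝ) (z u v : Phase n) :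
    IsLinearMap ℝ (sasakiDeriv F z u v) where
  map_add w w' := by
    simp only [sasakiDeriv, base_add, vert_add, mulVec_add, dotProduct_add]; ring
  map_smul c w := by
    simp only [sasakiDeriv, base_smul, vert_smul, mulVec_smul, dotProduct_smul, smul_eq_mul]; ring

lemma sum_comp_smul_frame (v : Phase n) : ∑ A, comp v A • frame A = v := by
  rw [Fintype.sum_sum_type]
  exact sum_eX_add_sum_eP v

lemma _root_.IsLinearMap.eq_sum_comp {f : Phase n → ℝ} (hf : IsLinearMap ℝ f) (v : Phase n) :
    f v = ∑ A, comp v A * f (frame A) := by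
  conv_lhs => rw [← sum_comp_smul_frame v]
  exact (map_sum (hf.mk' f) _ _).trans (Finset.sum_congr rfl fun A _ => hf.map_smul _ _)

lemma comp_sum_smul_frame (x : Fin n ⊕ Fin n → ℝ) : comp (∑ A, x A • frame A) = x := by
  rw [Fintype.sum_sum_type]
  ext (j | j) <;> simp [comp, frame, eX, eP, Prod.fst_sum, Prod.snd_sum, Pi.single_apply]

lemma sasaki_eq_dotProduct (F : Phase n → ℝ) (z v w : Phase n) :
    sasaki F z v w = comp v ⬝ᵥ (sasakiMat F z *ᵥ comp w) := by
  rw [(isLinearMap_sasaki_left F z w).eq_sum_comp v]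
  refine Finset.sum_congr rfl fun A _ => congrArg _ ?_
  rw [(isLinearMap_sasaki_right F z (frame A)).eq_sum_comp w]
  exact Finset.sum_congr rfl fun B _ => mul_comm _ _

namespace IsLocalCartan

variable {F : Phase n → ℝ} {U : Set (Phase n)} (hF : IsLocalCartan F U)
include hF

lemma sasaki_comm {z : Phase n} (hz : z ∈ U) (v w : Phase n) :
    sasaki F z v w = sasaki F z w v := by
  rw [sasaki_eq, sasaki_eq, dotProduct_mulVec, dotProduct_comm, ← mulVec_transpose,
    hF.gLow_transpose hz, dotProduct_mulVec (vert F z v), dotProduct_comm _ (vert F z w),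
    ← mulVec_transpose, hF.gUp_transpose hz]

lemma sasaki_self_pos {z : Phase n} (hz : z ∈ U) {v : Phase n} (hv : v ≠ 0) :
    0 < sasaki F z v v := by
  have hg := hF.posDef z hz
  have hl : (gLow F z).PosDef := hg.inv
  rw [sasaki_eq]
  by_cases hb : base v = 0
  · have hm : vert F z v ≠ 0 := by
      intro h
      rw [vert, hb, mulVec_zero, sub_zero] at h
      exact hv (Prod.ext (PiLp.ext (congrFun hb)) (PiLp.ext (congrFun h)))
    have := hg.dotProduct_mulVec_pos hm
    simpa [hb] using this
  · have h1 := hl.dotProduct_mulVec_pos hb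
    have h2 := hg.posSemidef.dotProduct_mulVec_nonneg (vert F z v)
    simp only [star_trivial] at h1 h2
    linarith

lemma sasakiMat_transpose {z : Phase n} (hz : z ∈ U) : (sasakiMat F z)ᵀ = sasakiMat F z := by
  ext A B
  exact hF.sasaki_comm hz _ _

/-- A kernel vector of the matrix would have length zero for `G`, against positivity. This makes the
inverse in the Christoffel symbols a genuine one. -/
lemma isUnit_det_sasakiMat {z : Phase n} (hz : z ∈ U) : IsUnit (sasakiMat F z).det := by
  refine isUnit_iff_ne_zero.2 fun h => ?_
  obtain ⟨x, hx, h0⟩ := Matrix.exists_mulVec_eq_zero_iff.2 h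
  have hv : ∑ A, x A • frame A ≠ 0 := by
    intro hv
    apply hx
    rw [← comp_sum_smul_frame x, hv]
    ext (j | j) <;> rfl
  have := hF.sasaki_self_pos hz hv
  rw [sasaki_eq_dotProduct, comp_sum_smul_frame, h0, dotProduct_zero] at this
  exact lt_irrefl _ this

lemma vecDeriv_vert {z : Phase n} (hz : z ∈ U) {Y : Phase n → Phase n}
    (hY : DifferentiableAt ℝ Y z) (u : Phase n) : vecDeriv (fun w => vert F w (Y w)) z u
      = vert F z (fderiv ℝ Y z u) - matDeriv (nonlinMat F) z u *ᵥ base (Y z) := by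
  have h1 := vecDeriv_mulVec (hF.differentiableAt_nonlin hz) (differentiableAt_base hY) u
  have h2 : vecDeriv (fun w => vert F w (Y w)) z u = vecDeriv (fun w => mom (Y w)) z u
      - vecDeriv (fun w => nonlinMat F w *ᵥ base (Y w)) z u := by
    ext i
    have := fderiv_fun_sub (differentiableAt_mom hY i)
      (differentiableAt_mulVec (hF.differentiableAt_nonlin hz) (differentiableAt_base hY) i)
    exact congrArg (fun T : Phase n →L[ℝ] ℝ => T u) this
  rw [h2, h1, vert, base_fderiv hY, mom_fderiv hY]
  abel

lemma differentiableAt_vert {z : Phase n} (hz : z ∈ U) {Y : Phase n → Phase n}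
    (hY : DifferentiableAt ℝ Y z) (i : Fin n) :
    DifferentiableAt ℝ (fun w => vert F w (Y w) i) z :=
  (differentiableAt_mom hY i).sub
    (differentiableAt_mulVec (hF.differentiableAt_nonlin hz) (differentiableAt_base hY) i)

lemma differentiableAt_sasaki {z : Phase n} (hz : z ∈ U) {X Y : Phase n → Phase n}
    (hX : DifferentiableAt ℝ X z) (hY : DifferentiableAt ℝ Y z) :
    DifferentiableAt ℝ (fun w => sasaki F w (X w) (Y w)) z := by
  simp only [sasaki_eq]
  exact (differentiableAt_dotProduct (differentiableAt_base hX)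
    (differentiableAt_mulVec (hF.differentiableAt_gLow hz) (differentiableAt_base hY))).add
    (differentiableAt_dotProduct (hF.differentiableAt_vert hz hX)
    (differentiableAt_mulVec (hF.differentiableAt_gUp hz) (hF.differentiableAt_vert hz hY)))

/-- The product rule for `G(X, Y)`. -/
lemma fderiv_sasaki {z : Phase n} (hz : z ∈ U) {X Y : Phase n → Phase n}
    (hX : DifferentiableAt ℝ X z) (hY : DifferentiableAt ℝ Y z) (u : Phase n) :
    fderiv ℝ (fun w => sasaki F w (X w) (Y w)) z u = sasakiDeriv F z u (X z) (Y z)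
      + sasaki F z (fderiv ℝ X z u) (Y z) + sasaki F z (X z) (fderiv ℝ Y z u) := by
  have hl := hF.differentiableAt_gLow hz
  have hg := hF.differentiableAt_gUp hz
  have bX := differentiableAt_base hX
  have bY := differentiableAt_base hY
  have vX := hF.differentiableAt_vert hz hX
  have vY := hF.differentiableAt_vert hz hY
  have h1 := fderiv_fun_add (differentiableAt_dotProduct bX (differentiableAt_mulVec hl bY))
    (differentiableAt_dotProduct vX (differentiableAt_mulVec hg vY))
  simp only [sasaki_eq]
  rw [h1, _root_.add_apply, fderiv_dotProduct_mulVec hl bX bY, fderiv_dotProduct_mulVec hg vX vY,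
    hF.vecDeriv_vert hz hX, hF.vecDeriv_vert hz hY, ← base_fderiv hX, ← base_fderiv hY, sasakiDeriv]
  simp only [mulVec_sub, sub_dotProduct, dotProduct_sub]
  ring

lemma fderiv_sasaki_const {z : Phase n} (hz : z ∈ U) (u v w : Phase n) :
    fderiv ℝ (fun y => sasaki F y v w) z u = sasakiDeriv F z u v w := by
  rw [hF.fderiv_sasaki hz (differentiableAt_const v) (differentiableAt_const w)]
  have h1 := (isLinearMap_sasaki_left F z w).map_zero
  have h2 := (isLinearMap_sasaki_right F z v).map_zero
  simpa using by rw [h1, h2, add_zero, add_zero]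

lemma isLinearMap_sasakiDeriv_left {z : Phase n} (hz : z ∈ U) (v w : Phase n) :
    IsLinearMap ℝ (fun u => sasakiDeriv F z u v w) := by
  simp only [← hF.fderiv_sasaki_const hz]
  exact (fderiv ℝ (fun y => sasaki F y v w) z).toLinearMap.isLinear

lemma sasakiDeriv_comm {z : Phase n} (hz : z ∈ U) (u v w : Phase n) :
    sasakiDeriv F z u v w = sasakiDeriv F z u w v := by
  rw [← hF.fderiv_sasaki_const hz, ← hF.fderiv_sasaki_const hz]
  refine congrArg (fun T : Phase n →L[ℝ] ℝ => T u) (Filter.EventuallyEq.fderiv_eq ?_)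
  filter_upwards [hF.isOpen.mem_nhds hz] with y hy
  exact hF.sasaki_comm hy v w

lemma sasakiDeriv_eq_sum {z : Phase n} (hz : z ∈ U) (u v w : Phase n) :
    sasakiDeriv F z u v w
      = ∑ A, ∑ B, ∑ D, comp u A * comp v B * comp w D * dSasaki F A B D z := by
  rw [(hF.isLinearMap_sasakiDeriv_left hz v w).eq_sum_comp u]
  refine Finset.sum_congr rfl fun A _ => ?_
  rw [(isLinearMap_sasakiDeriv_mid F z _ w).eq_sum_comp v, Finset.mul_sum]
  refine Finset.sum_congr rfl fun B _ => ?_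
  rw [(isLinearMap_sasakiDeriv_right F z _ _).eq_sum_comp w, Finset.mul_sum, Finset.mul_sum]
  refine Finset.sum_congr rfl fun D _ => ?_
  rw [← hF.fderiv_sasaki_const hz]
  simp only [dSasaki, sasakiMat, Matrix.of_apply]
  ring

/-- The Koszul formula for the Christoffel symbols. -/
lemma sasaki_sum_christoffel {z : Phase n} (hz : z ∈ U) (u v w : Phase n) :
    sasaki F z (∑ C, (∑ A, ∑ B, christoffel F C A B z * comp u A * comp v B) • frame C) w
      = (1 / 2 : ℝ) * (sasakiDeriv F z u v w + sasakiDeriv F z v u w - sasakiDeriv F z w u v) := by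
  set t : Fin n ⊕ Fin n → ℝ := fun D => ∑ A, ∑ B, (1 / 2 : ℝ) * (comp u A * comp v B *
    (dSasaki F A B D z + dSasaki F B A D z - dSasaki F D A B z)) with ht
  have h1 : (fun C => ∑ A, ∑ B, christoffel F C A B z * comp u A * comp v B)
      = (sasakiMat F z)⁻¹ *ᵥ t := by
    ext C
    simp only [christoffel, mulVec, dotProduct, ht, Finset.mul_sum, Finset.sum_mul]
    conv_rhs => rw [Finset.sum_comm]
    refine Finset.sum_congr rfl fun A _ => ?_
    rw [Finset.sum_comm]
    exact Finset.sum_congr rfl fun D _ => Finset.sum_congr rfl fun B _ => by ring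
  rw [sasaki_eq_dotProduct, comp_sum_smul_frame, h1, ← hF.sasakiMat_transpose hz,
    mulVec_transpose, dotProduct_comm, ← dotProduct_mulVec, hF.sasakiMat_transpose hz,
    mulVec_mulVec, Matrix.mul_nonsing_inv _ (hF.isUnit_det_sasakiMat hz), one_mulVec,
    hF.sasakiDeriv_eq_sum hz u v w, hF.sasakiDeriv_eq_sum hz v u w,
    hF.sasakiDeriv_eq_sum hz w u v]
  have h2 : ∑ A, ∑ B, ∑ D, comp v A * comp u B * comp w D * dSasaki F A B D z
      = ∑ A, ∑ B, ∑ D, comp u A * comp v B * comp w D * dSasaki F B A D z := by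
    rw [Finset.sum_comm]
    exact Finset.sum_congr rfl fun A _ => Finset.sum_congr rfl fun B _ =>
      Finset.sum_congr rfl fun D _ => by ring
  have h3 : ∑ A, ∑ B, ∑ D, comp w A * comp u B * comp v D * dSasaki F A B D z
      = ∑ A, ∑ B, ∑ D, comp u A * comp v B * comp w D * dSasaki F D A B z := by
    rw [Finset.sum_comm]
    refine Finset.sum_congr rfl fun A _ => ?_
    rw [Finset.sum_comm]
    exact Finset.sum_congr rfl fun B _ => Finset.sum_congr rfl fun D _ => by ring
  rw [h2, h3]
  simp only [← Finset.sum_add_distrib, ← Finset.sum_sub_distrib, Finset.mul_sum, dotProduct, ht]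
  rw [Finset.sum_comm]
  refine Finset.sum_congr rfl fun A _ => ?_
  rw [Finset.sum_comm]
  exact Finset.sum_congr rfl fun B _ => Finset.sum_congr rfl fun D _ => by ring

/-- The Koszul expressions for the pairs `(X, Y)` and `(Y, X)` coincide, so their sum absorbs the
factor ½. -/
lemma sasaki_nabla_add_nabla {z : Phase n} (hz : z ∈ U) (X Y : Phase n → Phase n) (w : Phase n) :
    sasaki F z (nabla F X Y z + nabla F Y X z) w
      = sasaki F z (fderiv ℝ Y z (X z)) w + sasaki F z (fderiv ℝ X z (Y z)) w
        + sasakiDeriv F z (X z) (Y z) w + sasakiDeriv F z (Y z) (X z) w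
        - sasakiDeriv F z w (X z) (Y z) := by
  have ha := (isLinearMap_sasaki_left F z w).map_add
  rw [ha, nabla, nabla, ha, ha, hF.sasaki_sum_christoffel hz, hF.sasaki_sum_christoffel hz,
    hF.sasakiDeriv_comm hz w (Y z)]
  ring

end IsLocalCartan

end CartanGeom

/-! ### The curvature matrices and the Lie derivative of `G`. -/

namespace CartanGeom

variable {n : ℕ}

open Matrix

/-- The matrix `(R_{ij})`. -/
def curvMat (F : Phase n → ℝ) (z : Phase n) : Matrix (Fin n) (Fin n) ℝ :=
  Matrix.of fun i j => curv2 F i j z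

/-- The matrix `(Λ*_{ij})`. -/
def angCurvMat (F : Phase n → ℝ) (z : Phase n) : Matrix (Fin n) (Fin n) ℝ :=
  Matrix.of fun i j => angCurv F i j z

lemma mulVec_dotProduct_mulVec (A B : Matrix (Fin n) (Fin n) ℝ) (x y : Fin n → ℝ) :
    (A *ᵥ x) ⬝ᵥ (B *ᵥ y) = x ⬝ᵥ ((Aᵀ * B) *ᵥ y) := by
  rw [← mulVec_mulVec, dotProduct_transpose_mulVec, dotProduct_comm]

namespace IsLocalCartan

variable {F : Phase n → ℝ} {U : Set (Phase n)} (hF : IsLocalCartan F U)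
include hF

lemma contDiffOn_ham : ContDiffOn ℝ ∞ (ham F) U :=
  ContDiffOn.prodMk
    (contDiffOn_piLp' 2 fun i => contDiffOn_const.mul
      (contDiffOn_dP hF.isOpen hF.contDiffOn_sqF i))
    (contDiffOn_piLp' 2 fun i => contDiffOn_const.mul
      (contDiffOn_dX hF.isOpen hF.contDiffOn_sqF i))

lemma differentiableAt_ham {z : Phase n} (hz : z ∈ U) : DifferentiableAt ℝ (ham F) z :=
  (hF.contDiffOn_ham.contDiffAt (hF.isOpen.mem_nhds hz)).differentiableAt (by simp)

lemma vert_ham {z : Phase n} (hz : z ∈ U) : vert F z (ham F z) = 0 := by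
  rw [vert, hF.base_ham hz, mom_ham, hF.nonlinMat_mulVec_vel hz, sub_self]

lemma curvMat_eq {z : Phase n} (hz : z ∈ U) :
    curvMat F z = dNonlinVel F z - matDeriv (nonlinMat F) z (ham F z) := by
  ext i j
  exact hF.curv2_eq hz i j

lemma matDeriv_nonlinMat_transpose {z : Phase n} (hz : z ∈ U) (u : Phase n) :
    (matDeriv (nonlinMat F) z u)ᵀ = matDeriv (nonlinMat F) z u :=
  matDeriv_congr (A := fun w => (nonlinMat F w)ᵀ) hF.isOpen
    (fun _ hw => hF.nonlinMat_transpose hw) hz u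

lemma curvMat_transpose {z : Phase n} (hz : z ∈ U) : (curvMat F z)ᵀ = curvMat F z := by
  rw [hF.curvMat_eq hz, transpose_sub, hF.dNonlinVel_transpose hz,
    hF.matDeriv_nonlinMat_transpose hz]

/-- The formula for `(D_u N) p^i` at `u = ξ`, which has no vertical part and base part `p^i`, shows
that the two terms of `R` agree on `p^i`. -/
lemma curvMat_mulVec_vel {z : Phase n} (hz : z ∈ U) : curvMat F z *ᵥ vel F z = 0 := by
  rw [hF.curvMat_eq hz, sub_mulVec, hF.matDeriv_nonlinMat_mulVec_vel hz, hF.vert_ham hz,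
    hF.base_ham hz, mulVec_zero, sub_zero, sub_self]

omit hF in
lemma angCurvMat_eq (z : Phase n) : angCurvMat F z
    = curvMat F z + (gLow F z - (F z ^ 2)⁻¹ • vecMulVec (mom z) (mom z)) := by
  ext i j
  simp only [angCurvMat, angCurv, angMetric, curvMat, Matrix.of_apply, Matrix.add_apply,
    Matrix.sub_apply, Matrix.smul_apply, vecMulVec_apply, smul_eq_mul, mom]
  ring

lemma angCurvMat_transpose {z : Phase n} (hz : z ∈ U) : (angCurvMat F z)ᵀ = angCurvMat F z := by
  rw [angCurvMat_eq, transpose_add, transpose_sub, transpose_smul, hF.curvMat_transpose hz,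
    hF.gLow_transpose hz, transpose_vecMulVec]

/-- Both summands annihilate `p^i`: the curvature by the lemma above, the angular metric because
`p_i p^i = K²`. -/
lemma angCurvMat_mulVec_vel {z : Phase n} (hz : z ∈ U) : angCurvMat F z *ᵥ vel F z = 0 := by
  have h0 : F z ^ 2 ≠ 0 := pow_ne_zero 2 (hF.pos z hz).ne'
  rw [angCurvMat_eq, add_mulVec, sub_mulVec, smul_mulVec, hF.curvMat_mulVec_vel hz,
    hF.gLow_mulVec_vel hz, vecMulVec_mulVec, hF.mom_dotProduct_vel hz,
    op_smul_eq_smul, smul_smul, inv_mul_cancel₀ h0, one_smul, sub_self, add_zero]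

/-! ### The Lie derivative of the Sasaki lift along `ξ` -/

lemma base_fderiv_ham {z : Phase n} (hz : z ∈ U) (v : Phase n) : base (fderiv ℝ (ham F) z v)
    = ((1 / 2 : ℝ) • mixedHess F z + gUp F z * nonlinMat F z) *ᵥ base v
      + gUp F z *ᵥ vert F z v := by
  have h3 : mom v = vert F z v + nonlinMat F z *ᵥ base v := by simp [vert]
  rw [base_fderiv (hF.differentiableAt_ham hz),
    vecDeriv_congr hF.isOpen (fun w hw => hF.base_ham hw) hz, hF.vecDeriv_vel hz, h3]
  simp only [mulVec_add, add_mulVec, smul_mulVec, ← mulVec_mulVec]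
  abel

/-- Differentiating `vert F w (ham F w) = 0` gives `(D_v N) p^i` for the vertical part, and the
curvature enters through `dNonlinVel = R + D_ξ N`. -/
lemma vert_fderiv_ham {z : Phase n} (hz : z ∈ U) (v : Phase n) : vert F z (fderiv ℝ (ham F) z v)
    = matDeriv (nonlinMat F) z (ham F z) *ᵥ base v + curvMat F z *ᵥ base v
      - ((1 / 2 : ℝ) • (mixedHess F z)ᵀ + nonlinMat F z * gUp F z) *ᵥ vert F z v := by
  have h1 := hF.vecDeriv_vert hz (hF.differentiableAt_ham hz) v
  have h2 : vecDeriv (fun w => vert F w (ham F w)) z v = 0 := by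
    rw [vecDeriv_congr hF.isOpen (y' := fun _ => 0) (fun w hw => hF.vert_ham hw) hz]
    ext i; simp [vecDeriv]
  rw [h2, hF.base_ham hz, hF.matDeriv_nonlinMat_mulVec_vel hz, eq_comm, sub_eq_zero] at h1
  rw [h1, hF.curvMat_eq hz, sub_mulVec]
  abel

/-- The left side is `(L_ξ G)(v, w)` for constant `v`, `w`. The derivatives of `g_{ij}` and `g^{ij}`
along `ξ` cancel the diagonal blocks, and the terms in `D_ξ N` cancel too. In the mixed block, `1`
comes from the base part of `Dξ` on vertical vectors and `R g⁻¹` from its vertical part on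
horizontal ones. -/
lemma lie_sasaki {z : Phase n} (hz : z ∈ U) (v w : Phase n) :
    sasakiDeriv F z (ham F z) v w + sasaki F z (fderiv ℝ (ham F) z v) w
        + sasaki F z v (fderiv ℝ (ham F) z w)
      = base v ⬝ᵥ (((1 + curvMat F z * gUp F z)) *ᵥ vert F z w)
        + base w ⬝ᵥ ((1 + curvMat F z * gUp F z) *ᵥ vert F z v) := by
  have e1 := hF.matDeriv_gLow_ham hz
  have e2 := hF.matDeriv_gUp_ham hz
  have c1 : base w ⬝ᵥ ((1 + curvMat F z * gUp F z) *ᵥ vert F z v)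
      = vert F z v ⬝ᵥ ((1 + gUp F z * curvMat F z) *ᵥ base w) := by
    rw [dotProduct_mulVec, dotProduct_comm, ← mulVec_transpose, transpose_add, transpose_mul,
      hF.gUp_transpose hz, hF.curvMat_transpose hz, transpose_one]
  have c2 : ∀ A : Matrix (Fin n) (Fin n) ℝ, gLow F z * (gUp F z * A) = A := fun A => by
    rw [← Matrix.mul_assoc, hF.gLow_mul_gUp hz, Matrix.one_mul]
  rw [c1]
  simp only [sasakiDeriv, sasaki_eq, hF.base_fderiv_ham hz, hF.vert_fderiv_ham hz, e1, e2]
  simp only [add_dotProduct, dotProduct_add, sub_dotProduct, dotProduct_sub, mulVec_add, mulVec_sub,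
    add_mulVec, sub_mulVec, smul_mulVec, mulVec_smul, neg_smul, neg_mulVec,
    dotProduct_neg, smul_dotProduct, dotProduct_smul, mulVec_dotProduct_mulVec, mulVec_mulVec,
    transpose_mul, transpose_transpose, smul_eq_mul, hF.gUp_transpose hz,
    hF.nonlinMat_transpose hz, hF.curvMat_transpose hz, hF.matDeriv_nonlinMat_transpose hz,
    one_mulVec, Matrix.mul_assoc, hF.gUp_mul_gLow hz, hF.gLow_mul_gUp hz, Matrix.mul_one, c2]
  ring

end IsLocalCartan

end CartanGeom

/-! ### Tangency to the levels of `K` and the main formula. -/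

namespace CartanGeom

variable {n : ℕ}

open Matrix

namespace IsLocalCartan

variable {F : Phase n → ℝ} {U : Set (Phase n)} (hF : IsLocalCartan F U)
include hF

lemma differentiableAt_self {z : Phase n} (hz : z ∈ U) : DifferentiableAt ℝ F z :=
  hF.smooth.differentiableAt_of_isOpen hF.isOpen hz

/-- By `nonlinMat_mulVec_vel` the horizontal part of `d(K²)` vanishes, so only the vertical part of
`v` counts. -/
lemma mul_fderiv {z : Phase n} (hz : z ∈ U) (v : Phase n) :
    F z * fderiv ℝ F z v = vert F z v ⬝ᵥ vel F z := by
  have h1 : fderiv ℝ (sqF F) z v = 2 * (F z * fderiv ℝ F z v) := by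
    refine (congrArg (fun T : Phase n →L[ℝ] ℝ => T v)
      (fderiv_fun_pow 2 (hF.differentiableAt_self hz))).trans ?_
    simp
    ring
  have h2 : fderiv ℝ (sqF F) z v = base v ⬝ᵥ baseGrad F z + 2 * (mom v ⬝ᵥ vel F z) := by
    rw [fderiv_eq_sum]
    simp only [hF.dP_sqF hz]
    refine congrArg₂ (· + ·) rfl ?_
    rw [dotProduct, Finset.mul_sum]
    exact Finset.sum_congr rfl fun i _ => by simp only [mom]; ring
  have h3 : (nonlinMat F z *ᵥ base v) ⬝ᵥ vel F z = -(1 / 2 : ℝ) * (base v ⬝ᵥ baseGrad F z) := by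
    rw [dotProduct_comm, dotProduct_mulVec, ← mulVec_transpose, hF.nonlinMat_transpose hz,
      hF.nonlinMat_mulVec_vel hz, smul_dotProduct, dotProduct_comm, smul_eq_mul]
  rw [vert, sub_dotProduct, h3]
  linarith

lemma sasaki_ham {z : Phase n} (hz : z ∈ U) (v : Phase n) :
    sasaki F z v (ham F z) = base v ⬝ᵥ mom z := by
  rw [sasaki_eq, hF.vert_ham hz, hF.base_ham hz, hF.gLow_mulVec_vel hz, mulVec_zero,
    dotProduct_zero, add_zero]

/-- A function that vanishes on the level set `{F = c}` has zero derivative along the directions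
tangent to it. -/
lemma fderiv_eq_zero_of_eqOn_level {c : ℝ} {W : Set (Phase n)} (hW : IsOpen W) {f : Phase n → ℝ}
    (hf : ∀ w ∈ W, F w = c → f w = 0) {z : Phase n} (hzW : z ∈ W) (hz : z ∈ U) (hzc : F z = c)
    (hd : DifferentiableAt ℝ f z) {v : Phase n} (hv : fderiv ℝ F z v = 0) :
    fderiv ℝ f z v = 0 := by
  have hFz := hF.pos z hz
  have hF0 : F z ≠ 0 := hFz.ne'
  have hquot : HasFDerivAt (fun w => c * (F w)⁻¹)
      (c • (-(F z ^ 2)⁻¹ • fderiv ℝ F z)) z :=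
    ((hasDerivAt_inv hF0).comp_hasFDerivAt z (hF.differentiableAt_self hz).hasFDerivAt).const_mul c
  have hr := (hasFDerivAt_fst (𝕜 := ℝ) (p := z)).prodMk
    (hquot.fun_smul (hasFDerivAt_snd (𝕜 := ℝ) (p := z)))
  -- Fibrewise rescaling onto `{F = c}`: by homogeneity `F ∘ r = c`, so `f ∘ r` vanishes near `z`.
  -- As `r` fixes `z` and its differential there fixes every `v` with `dF(v) = 0`, the chain rule
  -- gives the claim.
  set r : Phase n → Phase n := fun w => (w.1, (c * (F w)⁻¹) • w.2) with hrdef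
  have hrz : r z = z := by
    simp [hrdef, ← hzc, hF0]
  have h1 : HasFDerivAt f (fderiv ℝ f z) (r z) := by rw [hrz]; exact hd.hasFDerivAt
  have h2 := h1.comp z hr
  have hev : ∀ᶠ w in nhds z, (f ∘ r) w = 0 := by
    have hcont : ContinuousAt r z := hr.continuousAt
    have hrW : ∀ᶠ w in nhds z, r w ∈ W := hcont.eventually_mem (by
      rw [hrz]; exact hW.mem_nhds hzW)
    filter_upwards [hrW, hF.isOpen.mem_nhds hz] with w hw hwU
    refine hf _ hw ?_
    have hw0 := hF.pos w hwU
    rw [hrdef, hF.homog w hwU _ (mul_pos (hzc ▸ hFz) (inv_pos.2 hw0))]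
    field_simp
  have h3 := h2.unique ((hasFDerivAt_const (0 : ℝ) z).congr_of_eventuallyEq hev)
  have h4 := congrArg (fun T : Phase n →L[ℝ] ℝ => T v) h3
  have hv' : (c * (F z)⁻¹) = 1 := by rw [← hzc, mul_inv_cancel₀ hF0]
  simpa [hv, hv'] using h4

/-- The symmetrized covariant derivative of transverse fields in terms of the angular
curvature. -/
lemma sasaki_nabla_xi {c : ℝ} {W : Set (Phase n)} (hW : IsOpen W) (hWU : W ⊆ U)
    {X Y : Phase n → Phase n} (hX : ContDiffOn ℝ ∞ X W) (hY : ContDiffOn ℝ ∞ Y W)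
    (tX : ∀ w ∈ W, F w = c → fderiv ℝ F w (X w) = 0 ∧ sasaki F w (X w) (xi F w) = 0)
    (tY : ∀ w ∈ W, F w = c → fderiv ℝ F w (Y w) = 0 ∧ sasaki F w (Y w) (xi F w) = 0)
    {z : Phase n} (hzW : z ∈ W) (hzc : F z = c) :
    sasaki F z (nabla F X Y z + nabla F Y X z) (xi F z)
      = -(base (X z) ⬝ᵥ (angCurvMat F z *ᵥ (gUp F z *ᵥ vert F z (Y z)))
        + base (Y z) ⬝ᵥ (angCurvMat F z *ᵥ (gUp F z *ᵥ vert F z (X z)))) := by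
  have hz := hWU hzW
  have dX : DifferentiableAt ℝ X z := (hX.contDiffAt (hW.mem_nhds hzW)).differentiableAt (by simp)
  have dY : DifferentiableAt ℝ Y z := (hY.contDiffAt (hW.mem_nhds hzW)).differentiableAt (by simp)
  have dH := hF.differentiableAt_ham hz
  have perp : ∀ {Z : Phase n → Phase n}, DifferentiableAt ℝ Z z →
      -- Orthogonality to `ξ` is known only on the level set, so it may be differentiated only in
      -- tangent directions.
      (∀ w ∈ W, F w = c → fderiv ℝ F w (Z w) = 0 ∧ sasaki F w (Z w) (xi F w) = 0) →
      ∀ v, fderiv ℝ F z v = 0 → sasakiDeriv F z v (Z z) (ham F z)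
        + sasaki F z (fderiv ℝ Z z v) (ham F z) + sasaki F z (Z z) (fderiv ℝ (ham F) z v) = 0 := by
    intro Z dZ tZ v hv
    rw [← hF.fderiv_sasaki hz dZ dH v]
    refine hF.fderiv_eq_zero_of_eqOn_level hW (fun w hw hwc => ?_) hzW hz hzc
      (hF.differentiableAt_sasaki hz dZ dH) hv
    rw [← hF.xi_eq_ham (hWU hw)]
    exact (tZ w hw hwc).2
  -- The tangency of each field permits differentiating the orthogonality of the other along it.
  have hYX := perp dY tY _ (tX z hzW hzc).1
  have hXY := perp dX tX _ (tY z hzW hzc).1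
  -- Orthogonality to `ξ` says that `p` annihilates the base part of `u`, so the term `p pᵀ / K²` of
  -- `Λ*` does not contribute.
  have key : ∀ {u : Phase n}, sasaki F z u (ham F z) = 0 → ∀ y,
      base u ⬝ᵥ ((1 + curvMat F z * gUp F z) *ᵥ y)
        = base u ⬝ᵥ (angCurvMat F z *ᵥ (gUp F z *ᵥ y)) := by
    intro u hu y
    rw [hF.sasaki_ham hz] at hu
    rw [angCurvMat_eq, add_mulVec, add_mulVec, sub_mulVec, smul_mulVec, vecMulVec_mulVec, op_smul_eq_smul,
      mulVec_mulVec, mulVec_mulVec, hF.gLow_mul_gUp hz]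
    simp only [dotProduct_add, dotProduct_sub, dotProduct_smul, hu, smul_zero, sub_zero]
    ring
  have hlie := hF.lie_sasaki hz (X z) (Y z)
  have pX := (tX z hzW hzc).2
  have pY := (tY z hzW hzc).2
  rw [hF.xi_eq_ham hz] at pX pY ⊢
  rw [key pX, key pY] at hlie
  rw [hF.sasaki_nabla_add_nabla hz, ← hlie, hF.sasaki_comm hz (fderiv ℝ (ham F) z (X z))]
  linarith

lemma contDiffOn_dotProduct_div_sq (y : Phase n → Fin n → ℝ)
    (hy : ∀ i, ContDiffOn ℝ ∞ (fun w => y w i) U) (α : Fin n → ℝ) :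
    ContDiffOn ℝ ∞ (fun w => (y w ⬝ᵥ α) / F w ^ 2) U :=
  (ContDiffOn.sum (s := Finset.univ) fun i _ => (hy i).mul contDiffOn_const).div
    (hF.smooth.pow 2) fun w hw => pow_ne_zero 2 (hF.pos w hw).ne'

end IsLocalCartan

/-! ### Transverse test fields. -/

/-- The horizontal field with components `α^i - (p_j α^j / K²) p^i`. -/
def horField (F : Phase n → ℝ) (α : Fin n → ℝ) (w : Phase n) : Phase n :=
  (WithLp.toLp 2 (α - (mom w ⬝ᵥ α / F w ^ 2) • vel F w),
    WithLp.toLp 2 (nonlinMat F w *ᵥ (α - (mom w ⬝ᵥ α / F w ^ 2) • vel F w)))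

/-- The vertical field with components `β_i - (p^j β_j / K²) p_i`. -/
def verField (F : Phase n → ℝ) (β : Fin n → ℝ) (w : Phase n) : Phase n :=
  (0, WithLp.toLp 2 (β - (vel F w ⬝ᵥ β / F w ^ 2) • mom w))

lemma base_horField (F : Phase n → ℝ) (α : Fin n → ℝ) (w : Phase n) :
    base (horField F α w) = α - (mom w ⬝ᵥ α / F w ^ 2) • vel F w := rfl

lemma vert_horField (F : Phase n → ℝ) (α : Fin n → ℝ) (w : Phase n) :
    vert F w (horField F α w) = 0 := sub_self _

lemma base_verField (F : Phase n → ℝ) (β : Fin n → ℝ) (w : Phase n) :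
    base (verField F β w) = 0 := rfl

lemma vert_verField (F : Phase n → ℝ) (β : Fin n → ℝ) (w : Phase n) :
    vert F w (verField F β w) = β - (vel F w ⬝ᵥ β / F w ^ 2) • mom w := by
  rw [vert, base_verField, mulVec_zero, sub_zero]
  rfl

namespace IsLocalCartan

variable {F : Phase n → ℝ} {U : Set (Phase n)} (hF : IsLocalCartan F U)
include hF

omit hF in
lemma contDiffOn_mom (i : Fin n) : ContDiffOn ℝ ∞ (fun w : Phase n => mom w i) U :=
  ((EuclideanSpace.proj i : EuclideanSpace ℝ (Fin n) →L[ℝ] ℝ).comp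
    (ContinuousLinearMap.snd ℝ (EuclideanSpace ℝ (Fin n)) _)).contDiff.contDiffOn

lemma contDiffOn_horField (α : Fin n → ℝ) : ContDiffOn ℝ ∞ (horField F α) U := by
  have h : ∀ i, ContDiffOn ℝ ∞ (fun w => (α - (mom w ⬝ᵥ α / F w ^ 2) • vel F w) i) U := fun i =>
    contDiffOn_const.sub ((hF.contDiffOn_dotProduct_div_sq mom contDiffOn_mom α).mul
      (hF.contDiffOn_vel i))
  exact (contDiffOn_piLp' 2 h).prodMk (contDiffOn_piLp' 2 fun i =>
    ContDiffOn.sum (s := Finset.univ) fun j _ => (hF.contDiffOn_nonlin i j).mul (h j))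

lemma contDiffOn_verField (β : Fin n → ℝ) : ContDiffOn ℝ ∞ (verField F β) U :=
  contDiffOn_const.prodMk (contDiffOn_piLp' 2 fun i => contDiffOn_const.sub
    ((hF.contDiffOn_dotProduct_div_sq (vel F) hF.contDiffOn_vel β).mul (contDiffOn_mom i)))

lemma horField_transverse (α : Fin n → ℝ) {w : Phase n} (hw : w ∈ U) :
    fderiv ℝ F w (horField F α w) = 0 ∧ sasaki F w (horField F α w) (xi F w) = 0 := by
  have h0 := (hF.pos w hw).ne'
  constructor
  · have h := hF.mul_fderiv hw (horField F α w)
    rw [vert_horField, zero_dotProduct] at h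
    exact (mul_eq_zero.1 h).resolve_left h0
  · rw [hF.xi_eq_ham hw, hF.sasaki_ham hw, base_horField, sub_dotProduct, smul_dotProduct,
      dotProduct_comm (vel F w), hF.mom_dotProduct_vel hw, dotProduct_comm, smul_eq_mul,
      div_mul_cancel₀ _ (pow_ne_zero 2 h0), sub_self]

lemma verField_transverse (β : Fin n → ℝ) {w : Phase n} (hw : w ∈ U) :
    fderiv ℝ F w (verField F β w) = 0 ∧ sasaki F w (verField F β w) (xi F w) = 0 := by
  have h0 := (hF.pos w hw).ne'
  constructor
  · have h := hF.mul_fderiv hw (verField F β w)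
    rw [vert_verField, sub_dotProduct, smul_dotProduct, hF.mom_dotProduct_vel hw,
      dotProduct_comm, smul_eq_mul, div_mul_cancel₀ _ (pow_ne_zero 2 h0), sub_self] at h
    exact (mul_eq_zero.1 h).resolve_left h0
  · rw [hF.xi_eq_ham hw, hF.sasaki_ham hw, base_verField, zero_dotProduct]

/-- The projections alter `α` by a multiple of `p^i`, and `g⁻¹β` also by a multiple of `p^i`; `Λ*`
annihilates `p^i` on either side. -/
lemma horField_angCurv_verField {z : Phase n} (hz : z ∈ U) (α β : Fin n → ℝ) :
    base (horField F α z) ⬝ᵥ (angCurvMat F z *ᵥ (gUp F z *ᵥ vert F z (verField F β z)))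
      = α ⬝ᵥ (angCurvMat F z *ᵥ (gUp F z *ᵥ β)) := by
  have h1 : gUp F z *ᵥ mom z = vel F z := rfl
  have h2 : ∀ y, vel F z ⬝ᵥ (angCurvMat F z *ᵥ y) = 0 := fun y => by
    rw [dotProduct_mulVec, ← mulVec_transpose, hF.angCurvMat_transpose hz,
      hF.angCurvMat_mulVec_vel hz, zero_dotProduct]
  rw [base_horField, vert_verField, mulVec_sub, mulVec_sub, mulVec_smul, mulVec_smul, h1,
    hF.angCurvMat_mulVec_vel hz, smul_zero, sub_zero, sub_dotProduct, smul_dotProduct, h2,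
    smul_zero, sub_zero]

end IsLocalCartan

end CartanGeom

end

theorem mainTheorem3 {n : ℕ} {M : Type*} [TopologicalSpace M]
    [ChartedSpace (EuclideanSpace ℝ (Fin n)) M] [IsManifold (𝓡 n) ∞ M]
    (S : CartanGeom.CartanSpace n M) (c : ℝ) (hc : 0 < c) :
    S.IsBundleLike c ↔ S.AngularCurvatureVanishes c := by
  constructor
  · intro h φ hφ z hz hzc i j
    have hF := S.isLocalCartan_localK hφ
    have tX := fun α w (hw : w ∈ CartanGeom.slit φ) (_ : S.localK φ w = c) =>
      hF.horField_transverse α hw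
    have tY := fun β w (hw : w ∈ CartanGeom.slit φ) (_ : S.localK φ w = c) =>
      hF.verField_transverse β hw
    have key := fun α β => h φ hφ _ hF.isOpen subset_rfl _ _ (hF.contDiffOn_horField α)
      (hF.contDiffOn_verField β) (tX α) (tY β) z hz hzc
    -- The vertical test covector is `g e_j`, so that raising its index returns `e_j` and the
    -- pairing is the entry `Λ*_{ij}`. The other mixed term vanishes because the vertical field has
    -- no base part.
    have h1 := key (Pi.single i 1) ((CartanGeom.gLow (S.localK φ) z).mulVec (Pi.single j 1))
    rw [hF.sasaki_nabla_xi hF.isOpen subset_rfl (hF.contDiffOn_horField _)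
      (hF.contDiffOn_verField _) (tX _) (tY _) hz hzc, hF.horField_angCurv_verField hz,
      CartanGeom.base_verField, Matrix.mulVec_mulVec _ (CartanGeom.gUp _ z), hF.gUp_mul_gLow hz,
      Matrix.one_mulVec, zero_dotProduct, add_zero, neg_eq_zero, Matrix.mulVec_single_one,
      single_one_dotProduct] at h1
    exact h1
  · intro h φ hφ W hW hWs X Y hX hY tX tY z hz hzc
    have hF := S.isLocalCartan_localK hφ
    have h0 : CartanGeom.angCurvMat (S.localK φ) z = 0 := by
      ext i j
      exact h φ hφ z (hWs hz) hzc i j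
    rw [hF.sasaki_nabla_xi hW hWs hX hY tX tY hz hzc, h0]
    simp
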